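/- Let $q\in(0,1)$ and let $X\subset[0,\infty)$ be a non-empty closed set with $qX=X$ and $X\neq\{0\}$. For $Y=X$ or $Y=X\setminus\{0\}$ let $\alpha_q$ be the automorphism $(\alpha_q f)(x)=f(qx)$ of $C_0(Y)$. Let $\mathrm{alg}\{C_0(Y),U\}$ be the $*$-algebra of finite formal sums $\sum_{k} f_kU^k$ ($f_k\in C_0(Y)$, $k\in\mathbb Z$) with $fU^n\,gU^m=f\alpha_q^n(g)U^{n+m}$ and $(fU^n)^*=\alpha_q^{-n}(\bar f)U^{-n}$. A covariant representation is a pair of a unitary operator $V$ and a $*$-representation $\pi_0$ of $C_0(Y)$ on the same Hilbert space with $V\pi_0(f)=\pi_0(\alpha_q(f))V$ for all $f$; it gives the $*$-representation $\pi\big(\sum f_kU^k\big)=\sum\pi_0(f_k)V^k$. The crossed product $C_0(Y)\rtimes\mathbb Z$ is the C*-algebra obtained by completing $\mathrm{alg}\{C_0(Y),U\}$ in the norm $\|a\|=\sup\{\|\pi(a)\|:\pi \text{ a covariant representation}\}$. A $q$-normal operator is a densely defined closed operator $\zeta$ on a Hilbert space $\mathcal H$ with $\zeta\zeta^*=q^2\zeta^*\zeta$;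 its polar decomposition is written $\zeta=u|\zeta|$ with $|\zeta|=(\zeta^*\zeta)^{1/2}$ and $u$ a partial isometry with $\ker u=\ker\zeta$. (When $\ker|\zeta|=\{0\}$, $u$ is unitary, so that $u^{-1}=u^*$.) For $f\in C_0(Y)$, the operator $f(|\zeta|)$ is given by the functional calculus of the self-adjoint operator $|\zeta|$, where functions on $X\setminus\{0\}$ are extended to $0$ by the value $0$. Then there exists a $q$-normal operator $\zeta$ on a separable Hilbert space with $\mathrm{spec}(|\zeta|)=X$ and $\ker(|\zeta|)=\{0\}$. Moreover, for every $q$-normal operator $\zeta=u|\zeta|$ on a Hilbert space $\mathcal H$ with $\mathrm{spec}(|\zeta|)=X$ and $\ker(|\zeta|)=\{0\}$, the norm closures $$\mathcal B_1=\overline{\Big\{\sum_{\text{finite}} f_k(|\zeta|)u^k : f_k\in C_0(X),\ k\in\mathbb Z\Big\}},\qquad \mathcal B_0=\overline{\Big\{\sum_{\text{finite}} f_k(|\zeta|)u^k : f_k\in C_0(X\setminus\{0\}),\ k\in\mathbb Z\Big\}}$$ in $B(\mathcal H)$ are $*$-subalgebras of $B(\mathcal H)$, and there are $*$-isomorphisms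 $$C_0(X)\rtimes\mathbb Z\cong\mathcal B_1,\qquad C_0(X\setminus\{0\})\rtimes\mathbb Z\cong\mathcal B_0,$$ each of which maps $fU^k$ to $f(|\zeta|)u^k$ for all $k\in\mathbb Z$ and all $f\in C_0(X)$, respectively $f\in C_0(X\setminus\{0\})$. -/

import Mathlib

open scoped ZeroAtInfty InnerProductSpace

universe u v

noncomputable section

namespace QPlane

/-! ### Unbounded operators -/

section Operators

variable {H : Type u} [NormedAddCommGroup H] [InnerProductSpace ℂ H]

/-- The product `A B` of two partially defined operators, on its natural domain
`{x ∈ dom B | B x ∈ dom A}`. -/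
def opComp (A B : H →ₗ.[ℂ] H) : H →ₗ.[ℂ] H :=
  A.comp (B.domRestrict ((A.domain.comap B.toFun).map B.domain.subtype)) (by
    rintro ⟨x, hx⟩
    obtain ⟨⟨y, hy, rfl⟩, hx'⟩ := hx
    exact hy)

/-- `S` is a bounded, everywhere defined, two-sided inverse of `T - z`. -/
def IsResolventAt (T : H →ₗ.[ℂ] H) (z : ℂ) (S : H →L[ℂ] H) : Prop :=
  (∀ x : H, ∃ hx : S x ∈ T.domain, T ⟨S x, hx⟩ - z • S x = x) ∧
    ∀ x : T.domain, S (T x - z • (x : H)) = x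

/-- The spectrum of a partially defined operator: the complement of the resolvent set. -/
def opSpectrum (T : H →ₗ.[ℂ] H) : Set ℂ :=
  {z | ¬ ∃ S : H →L[ℂ] H, IsResolventAt T z S}

open Classical in
/-- The bounded operator `(T - z)⁻¹` for `z` in the resolvent set of `T`. -/
def opResolvent (T : H →ₗ.[ℂ] H) (z : ℂ) : H →L[ℂ] H :=
  if h : ∃ S : H →L[ℂ] H, IsResolventAt T z S then h.choose else 0

variable [CompleteSpace H]

/-- A `q`-normal operator: densely defined, closed, and `ζ ζ* = q² ζ* ζ`
(an equality of operators including their natural domains). -/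
structure IsQNormal (q : ℝ) (ζ : H →ₗ.[ℂ] H) : Prop where
  dense_domain : Dense (ζ.domain : Set H)
  isClosed : ζ.IsClosed
  comm : opComp ζ ζ.adjoint = ((q : ℂ) ^ 2) • opComp ζ.adjoint ζ

/-- `T` is the modulus `|ζ| = (ζ* ζ)^{1/2}`: the positive self-adjoint operator with
square `ζ* ζ`. -/
structure IsModulus (ζ T : H →ₗ.[ℂ] H) : Prop where
  isSelfAdjoint : IsSelfAdjoint T
  nonneg : ∀ x : T.domain, 0 ≤ (⟪(x : H), T x⟫_ℂ).re
  sq : opComp T T = opComp ζ.adjoint ζ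

/-- `ζ = u T` is the polar decomposition of `ζ`: `T = |ζ|`, `u` is a partial isometry with
`ker u = ker ζ`, and `ζ = u T` with equality of domains. -/
structure IsPolarDecomposition (ζ : H →ₗ.[ℂ] H) (u : H →L[ℂ] H) (T : H →ₗ.[ℂ] H) : Prop where
  modulus : IsModulus ζ T
  partialIsometry : u * star u * u = u
  ker_eq : ∀ x : H, u x = 0 ↔ ∃ hx : x ∈ ζ.domain, ζ ⟨x, hx⟩ = 0
  eq_comp : ζ = (u : H →ₗ[ℂ] H).compPMap T

/-- The functional calculus `f(T)` of a positive self-adjoint operator `T`, for functions `f` that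
are continuous on the spectrum of `T` and vanish at infinity there. The map
`t ↦ r = (t + 1)⁻¹` is a homeomorphism of `[0, ∞]` onto `[0, 1]` which sends `T` to the bounded
positive operator `(T + 1)⁻¹`; so `f(T)` is the value at `(T + 1)⁻¹` of the function
`r ↦ f (r⁻¹ - 1)` (`0` at `r = 0`, i.e. at `t = ∞`) under the continuous functional calculus. -/
def funCalc (T : H →ₗ.[ℂ] H) (f : ℝ → ℂ) : H →L[ℂ] H :=
  cfc (fun r : ℂ => if r = 0 then 0 else f (r⁻¹ - 1).re) (opResolvent T (-1))

open Classical in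
/-- `f(T)` for `f ∈ C₀(Y)`, `Y ⊆ ℝ`; `f` is extended by zero outside `Y` (which matters only for
a point of the spectrum of `T` that is not in `Y`). -/
def funCalc₀ (T : H →ₗ.[ℂ] H) {Y : Set ℝ} (f : C₀(Y, ℂ)) : H →L[ℂ] H :=
  funCalc T (fun t => if ht : t ∈ Y then f ⟨t, ht⟩ else 0)

/-- Integer powers of a unitary operator `u`, with `u⁻ⁿ = (u*)ⁿ`. -/
def opZPow (u : H →L[ℂ] H) : ℤ → (H →L[ℂ] H)
  | Int.ofNat n => u ^ n
  | Int.negSucc n => star u ^ (n + 1)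

/-- The finite sums `∑ₖ fₖ(T) uᵏ` with `fₖ ∈ C₀(Y)`, `k ∈ ℤ`. -/
def finiteSums (T : H →ₗ.[ℂ] H) (u : H →L[ℂ] H) (Y : Set ℝ) : Set (H →L[ℂ] H) :=
  {b | ∃ (s : Finset ℤ) (f : ℤ → C₀(Y, ℂ)), b = ∑ k ∈ s, funCalc₀ T (f k) * opZPow u k}

end Operators

/-! ### The crossed product of `C₀(Y)` by the action of `ℤ` generated by a homeomorphism -/

section CrossedProduct

variable {Y : Type v} [TopologicalSpace Y]

/-- The automorphism `αⁿ` of `C₀(Y)`, where `α f = f ∘ h`. -/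
def alpha (h : Y ≃ₜ Y) (n : ℤ) (f : C₀(Y, ℂ)) : C₀(Y, ℂ) :=
  f.comp (h ^ n).toCocompactMap

lemma alpha_apply (h : Y ≃ₜ Y) (n : ℤ) (f : C₀(Y, ℂ)) (y : Y) :
    alpha h n f y = f ((h ^ n) y) := rfl

lemma alpha_add (h : Y ≃ₜ Y) (n : ℤ) (f g : C₀(Y, ℂ)) :
    alpha h n (f + g) = alpha h n f + alpha h n g := rfl

lemma alpha_mul (h : Y ≃ₜ Y) (n : ℤ) (f g : C₀(Y, ℂ)) :
    alpha h n (f * g) = alpha h n f * alpha h n g := rfl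

lemma alpha_smul (h : Y ≃ₜ Y) (n : ℤ) (c : ℂ) (f : C₀(Y, ℂ)) :
    alpha h n (c • f) = c • alpha h n f := rfl

lemma alpha_star (h : Y ≃ₜ Y) (n : ℤ) (f : C₀(Y, ℂ)) :
    alpha h n (star f) = star (alpha h n f) := rfl

lemma alpha_zero (h : Y ≃ₜ Y) (n : ℤ) : alpha h n 0 = 0 := rfl

lemma alpha_alpha (h : Y ≃ₜ Y) (n m : ℤ) (f : C₀(Y, ℂ)) :
    alpha h n (alpha h m f) = alpha h (n + m) f := by
  ext y
  simp only [alpha_apply]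
  rw [add_comm, zpow_add]
  rfl

lemma alpha_id (h : Y ≃ₜ Y) (f : C₀(Y, ℂ)) : alpha h 0 f = f := by
  ext y
  simp [alpha_apply]

/-- The underlying space of the `*`-algebra `*-alg{C₀(Y), U}` of finite sums `∑ₖ fₖ Uᵏ`. An
element is its finitely supported family of coefficients `k ↦ fₖ`; `ULift` only records the
universe of the Hilbert spaces that are used to define the norm. -/
def ConvAlg.{a, b} {Y : Type b} [TopologicalSpace Y] (_h : Y ≃ₜ Y) : Type (max a b) :=
  ULift.{a} (ℤ →₀ C₀(Y, ℂ))

namespace ConvAlg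

variable {h : Y ≃ₜ Y}

instance : AddCommGroup (ConvAlg.{u} h) := inferInstanceAs (AddCommGroup (ULift.{u} (ℤ →₀ C₀(Y, ℂ))))
instance : Module ℂ (ConvAlg.{u} h) := inferInstanceAs (Module ℂ (ULift.{u} (ℤ →₀ C₀(Y, ℂ))))

/-- `*-alg{C₀(Y), U}` is, as a vector space, the space of families of coefficients. -/
def coeffs (h : Y ≃ₜ Y) : ConvAlg.{u} h ≃ₗ[ℂ] (ℤ →₀ C₀(Y, ℂ)) :=
  (ULift.moduleEquiv : ULift.{u} (ℤ →₀ C₀(Y, ℂ)) ≃ₗ[ℂ] (ℤ →₀ C₀(Y, ℂ)))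

/-- The element `f Uⁿ`. -/
def mono (h : Y ≃ₜ Y) (n : ℤ) : C₀(Y, ℂ) →ₗ[ℂ] ConvAlg.{u} h :=
  (coeffs h).symm.toLinearMap ∘ₗ Finsupp.lsingle (R := ℂ) (M := C₀(Y, ℂ)) n

/-- The linear map defined by prescribing it on the elements `f Uⁿ`. -/
def lift {M : Type*} [AddCommGroup M] [Module ℂ M] (φ : ℤ → C₀(Y, ℂ) →ₗ[ℂ] M) :
    ConvAlg.{u} h →ₗ[ℂ] M :=
  Finsupp.lsum ℂ (M := C₀(Y, ℂ)) φ ∘ₗ (coeffs h).toLinearMap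

@[simp]
lemma lift_mono {M : Type*} [AddCommGroup M] [Module ℂ M] (φ : ℤ → C₀(Y, ℂ) →ₗ[ℂ] M) (n : ℤ)
    (f : C₀(Y, ℂ)) : lift φ (mono.{u} h n f) = φ n f := by
  simp [lift, mono]

@[elab_as_elim]
lemma induction {p : ConvAlg.{u} h → Prop} (a : ConvAlg.{u} h) (h0 : p 0)
    (hm : ∀ n f, p (mono.{u} h n f)) (ha : ∀ a b, p a → p b → p (a + b)) : p a :=
  Finsupp.induction_linear (motive := fun b => p ((coeffs h).symm b)) (coeffs h a) h0
    (fun _ _ hb hc => ha _ _ hb hc) hm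

/-- The convolution product as a bilinear map: `(f Uⁿ) (g Uᵐ) = f αⁿ(g) Uⁿ⁺ᵐ`. -/
def mulBilin (h : Y ≃ₜ Y) : ConvAlg.{u} h →ₗ[ℂ] ConvAlg.{u} h →ₗ[ℂ] ConvAlg.{u} h :=
  lift fun n => LinearMap.flip (lift fun m =>
    LinearMap.mk₂ ℂ (fun g f => mono.{u} h (n + m) (f * alpha h n g))
      (fun g g' f => by rw [alpha_add, mul_add, map_add])
      (fun c g f => by rw [alpha_smul, mul_smul_comm, map_smul])
      (fun g f f' => by rw [add_mul, map_add])
      (fun c g f => by rw [smul_mul_assoc, map_smul]))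

instance : Mul (ConvAlg.{u} h) := ⟨fun a b => mulBilin h a b⟩

lemma mul_def (a b : ConvAlg.{u} h) : a * b = mulBilin h a b := rfl

lemma mono_mul_mono (n m : ℤ) (f g : C₀(Y, ℂ)) :
    mono.{u} h n f * mono.{u} h m g = mono.{u} h (n + m) (f * alpha h n g) := by
  simp [mul_def, mulBilin, LinearMap.flip_apply]

instance : NonUnitalRing (ConvAlg.{u} h) where
  left_distrib a b c := by simp only [mul_def, map_add]
  right_distrib a b c := by simp only [mul_def, map_add, LinearMap.add_apply]
  zero_mul a := by simp only [mul_def, map_zero, LinearMap.zero_apply]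
  mul_zero a := by simp only [mul_def, map_zero]
  mul_assoc a b c := by
    refine induction a ?_ (fun n f => ?_) (fun a a' ha ha' => ?_)
    · simp only [mul_def, map_zero, LinearMap.zero_apply]
    · refine induction b ?_ (fun m g => ?_) (fun b b' hb hb' => ?_)
      · simp only [mul_def, map_zero, LinearMap.zero_apply]
      · refine induction c ?_ (fun k e => ?_) (fun c c' hc hc' => ?_)
        · simp only [mul_def, map_zero]
        · simp only [mono_mul_mono, alpha_mul, alpha_alpha, mul_assoc, add_assoc]
        · simp only [mul_def, map_add] at hc hc' ⊢
          rw [hc, hc']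
      · simp only [mul_def, map_add, LinearMap.add_apply] at hb hb' ⊢
        rw [hb, hb']
    · simp only [mul_def, map_add, LinearMap.add_apply] at ha ha' ⊢
      rw [ha, ha']

instance : IsScalarTower ℂ (ConvAlg.{u} h) (ConvAlg.{u} h) :=
  ⟨fun c a b => by simp only [smul_eq_mul, mul_def, map_smul, LinearMap.smul_apply]⟩

instance : SMulCommClass ℂ (ConvAlg.{u} h) (ConvAlg.{u} h) :=
  ⟨fun c a b => by simp only [smul_eq_mul, mul_def, map_smul]⟩

/-- The involution as an additive map: `(f Uⁿ)* = α⁻ⁿ(f̄) U⁻ⁿ`. -/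
def starHom (h : Y ≃ₜ Y) : ConvAlg.{u} h →+ ConvAlg.{u} h :=
  (Finsupp.liftAddHom (M := C₀(Y, ℂ)) fun n =>
    { toFun := fun f => mono.{u} h (-n) (alpha h (-n) (star f))
      map_zero' := by rw [star_zero, alpha_zero, map_zero]
      map_add' := fun f g => by rw [star_add, alpha_add, map_add] }).comp
    (coeffs h).toLinearMap.toAddMonoidHom

instance : Star (ConvAlg.{u} h) := ⟨fun a => starHom h a⟩

lemma star_def (a : ConvAlg.{u} h) : star a = starHom h a := rfl

lemma star_mono (n : ℤ) (f : C₀(Y, ℂ)) :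
    star (mono.{u} h n f) = mono.{u} h (-n) (alpha h (-n) (star f)) := by
  simp [star_def, starHom, mono]
  rw [Finsupp.sum_single_index]
  simp [alpha_zero]

instance : StarRing (ConvAlg.{u} h) where
  star_involutive a := by
    refine induction a ?_ (fun n f => ?_) (fun a a' ha ha' => ?_)
    · simp only [star_def, map_zero]
    · simp only [star_mono, alpha_star, alpha_alpha, star_star, neg_neg, add_neg_cancel,
        alpha_id]
    · simp only [star_def, map_add] at ha ha' ⊢
      rw [ha, ha']
  star_add a b := by simp only [star_def, map_add]
  star_mul a b := by
    refine induction a ?_ (fun n f => ?_) (fun a a' ha ha' => ?_)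
    · simp only [zero_mul, mul_zero, star_def, map_zero]
    · refine induction b ?_ (fun m g => ?_) (fun b b' hb hb' => ?_)
      · simp only [zero_mul, mul_zero, star_def, map_zero]
      · simp only [mono_mul_mono, star_mono, alpha_star, alpha_alpha, alpha_mul]
        congr 2
        · ring
        · have e : -(n + m) = -m + -n := by ring
          have e' : -(n + m) + n = -m := by ring
          rw [e', e]
          ext y
          simp [mul_comm]
      · simp only [mul_add, add_mul, star_def, map_add] at hb hb' ⊢
        rw [hb, hb']
    · simp only [mul_add, add_mul, star_def, map_add] at ha ha' ⊢
      rw [ha, ha']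

instance : StarModule ℂ (ConvAlg.{u} h) where
  star_smul c a := by
    refine induction a ?_ (fun n f => ?_) (fun a a' ha ha' => ?_)
    · simp only [smul_zero, star_def, map_zero]
    · rw [← map_smul, star_mono, star_mono, star_smul, alpha_smul, map_smul]
    · simp only [smul_add, star_def, map_add] at ha ha' ⊢
      rw [ha, ha']

end ConvAlg

/-- A covariant representation: a unitary operator `V` and a `*`-representation `π₀` of `C₀(Y)` on
a Hilbert space with `V π₀(f) = π₀(α f) V`. -/
structure CovRep (h : Y ≃ₜ Y) where
  /-- the Hilbert space -/
  H : Type u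
  [normed : NormedAddCommGroup H]
  [inner : InnerProductSpace ℂ H]
  [complete : CompleteSpace H]
  /-- the unitary operator -/
  V : unitary (H →L[ℂ] H)
  /-- the representation of `C₀(Y)` -/
  rep : C₀(Y, ℂ) →⋆ₙₐ[ℂ] (H →L[ℂ] H)
  covariant : ∀ f, (V : H →L[ℂ] H) * rep f = rep (alpha h 1 f) * V

namespace CovRep

attribute [instance] CovRep.normed CovRep.inner CovRep.complete

variable {h : Y ≃ₜ Y} (π : CovRep.{u} h)

/-- The representation `∑ fₖ Uᵏ ↦ ∑ π₀(fₖ) Vᵏ` of `*-alg{C₀(Y), U}`. -/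
def eval : ConvAlg.{u} h →ₗ[ℂ] (π.H →L[ℂ] π.H) :=
  ConvAlg.lift fun n =>
    { toFun := fun f => π.rep f * ((π.V ^ n : unitary (π.H →L[ℂ] π.H)) : π.H →L[ℂ] π.H)
      map_add' := fun f g => by rw [map_add, add_mul]
      map_smul' := fun c f => by rw [map_smul, smul_mul_assoc, RingHom.id_apply] }

lemma eval_mono (n : ℤ) (f : C₀(Y, ℂ)) : π.eval (ConvAlg.mono.{u} h n f) =
    π.rep f * ((π.V ^ n : unitary (π.H →L[ℂ] π.H)) : π.H →L[ℂ] π.H) :=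
  ConvAlg.lift_mono _ n f

lemma covariant_zpow (n : ℤ) (f : C₀(Y, ℂ)) :
    ((π.V ^ n : unitary (π.H →L[ℂ] π.H)) : π.H →L[ℂ] π.H) * π.rep f =
      π.rep (alpha h n f) * ((π.V ^ n : unitary (π.H →L[ℂ] π.H)) : π.H →L[ℂ] π.H) := by
  induction n using Int.induction_on generalizing f with
  | zero => simp [alpha_id]
  | succ n ih =>
    rw [zpow_add_one, Submonoid.coe_mul, mul_assoc, π.covariant, ← mul_assoc, ih, alpha_alpha,
      mul_assoc]
  | pred n ih =>
    have key : ((π.V⁻¹ : unitary (π.H →L[ℂ] π.H)) : π.H →L[ℂ] π.H) * π.rep f =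
        π.rep (alpha h (-1) f) * ((π.V⁻¹ : unitary (π.H →L[ℂ] π.H)) : π.H →L[ℂ] π.H) := by
      have h1 := π.covariant (alpha h (-1) f)
      rw [alpha_alpha, add_neg_cancel, alpha_id] at h1
      have e1 : ((π.V⁻¹ : unitary (π.H →L[ℂ] π.H)) : π.H →L[ℂ] π.H) * (π.V : π.H →L[ℂ] π.H) = 1 := by
        rw [← Submonoid.coe_mul, inv_mul_cancel]; rfl
      have e2 : (π.V : π.H →L[ℂ] π.H) * ((π.V⁻¹ : unitary (π.H →L[ℂ] π.H)) : π.H →L[ℂ] π.H) = 1 := by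
        rw [← Submonoid.coe_mul, mul_inv_cancel]; rfl
      calc _ = ((π.V⁻¹ : unitary (π.H →L[ℂ] π.H)) : π.H →L[ℂ] π.H) * (π.rep f *
              ((π.V : π.H →L[ℂ] π.H) *
                ((π.V⁻¹ : unitary (π.H →L[ℂ] π.H)) : π.H →L[ℂ] π.H))) := by rw [e2, mul_one]
        _ = _ := by
            rw [← mul_assoc (π.rep f), ← h1, mul_assoc, ← mul_assoc, e1, one_mul]
    rw [zpow_sub_one, Submonoid.coe_mul, mul_assoc, key, ← mul_assoc, ih, alpha_alpha, mul_assoc,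
      sub_eq_add_neg]

lemma eval_mul (a b : ConvAlg.{u} h) : π.eval (a * b) = π.eval a * π.eval b := by
  refine ConvAlg.induction a ?_ (fun n f => ?_) (fun a a' ha ha' => ?_)
  · simp only [zero_mul, map_zero]
  · refine ConvAlg.induction b ?_ (fun m g => ?_) (fun b b' hb hb' => ?_)
    · simp only [mul_zero, map_zero]
    · rw [ConvAlg.mono_mul_mono, eval_mono, eval_mono, eval_mono, map_mul, zpow_add,
        Submonoid.coe_mul, mul_assoc, mul_assoc, ← mul_assoc (π.rep (alpha h n g)),
        ← covariant_zpow, mul_assoc]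
    · rw [mul_add, map_add, map_add, mul_add, hb, hb']
  · rw [add_mul, map_add, map_add, add_mul, ha, ha']

lemma eval_star (a : ConvAlg.{u} h) : π.eval (star a) = star (π.eval a) := by
  refine ConvAlg.induction a ?_ (fun n f => ?_) (fun a a' ha ha' => ?_)
  · simp only [star_zero, map_zero]
  · rw [ConvAlg.star_mono, eval_mono, eval_mono, star_mul, ← covariant_zpow, map_star, zpow_neg,
      ← Unitary.star_eq_inv, Unitary.coe_star]
  · rw [star_add, map_add, map_add, star_add, ha, ha']

lemma norm_eval_mono_le (n : ℤ) (f : C₀(Y, ℂ)) : ‖π.eval (ConvAlg.mono.{u} h n f)‖ ≤ ‖f‖ := by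
  rw [eval_mono, CStarRing.norm_mul_coe_unitary]
  let _ : NonUnitalCStarAlgebra C₀(Y, ℂ) := { }
  exact NonUnitalStarAlgHom.norm_apply_le π.rep f

end CovRep

namespace ConvAlg

variable {h : Y ≃ₜ Y}

/-- The universal norm `sup {‖π(a)‖ : π a covariant representation}`. -/
def univNorm (a : ConvAlg.{u} h) : ℝ := ⨆ π : CovRep.{u} h, ‖π.eval a‖

lemma bddAbove_norm_eval (a : ConvAlg.{u} h) :
    BddAbove (Set.range fun π : CovRep.{u} h => ‖π.eval a‖) := by
  refine induction a ?_ (fun n f => ?_) (fun a a' ha ha' => ?_)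
  · exact ⟨0, by rintro _ ⟨π, rfl⟩; simp⟩
  · exact ⟨‖f‖, by rintro _ ⟨π, rfl⟩; exact π.norm_eval_mono_le n f⟩
  · obtain ⟨C, hC⟩ := ha
    obtain ⟨C', hC'⟩ := ha'
    refine ⟨C + C', ?_⟩
    rintro _ ⟨π, rfl⟩
    simp only [map_add]
    exact (norm_add_le _ _).trans (add_le_add (hC ⟨π, rfl⟩) (hC' ⟨π, rfl⟩))

lemma norm_eval_le (π : CovRep.{u} h) (a : ConvAlg.{u} h) : ‖π.eval a‖ ≤ univNorm.{u} a :=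
  le_ciSup (bddAbove_norm_eval.{u} a) π

lemma univNorm_nonneg (a : ConvAlg.{u} h) : 0 ≤ univNorm.{u} a :=
  Real.iSup_nonneg fun _ => norm_nonneg _

lemma univNorm_le {a : ConvAlg.{u} h} {C : ℝ} (hC : 0 ≤ C) (H : ∀ π : CovRep.{u} h, ‖π.eval a‖ ≤ C) :
    univNorm.{u} a ≤ C :=
  Real.iSup_le H hC

/-- The universal norm makes `*-alg{C₀(Y), U}` a (semi)normed group. -/
instance : SeminormedAddCommGroup (ConvAlg.{u} h) :=
  AddGroupSeminorm.toSeminormedAddCommGroup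
    { toFun := univNorm.{u}
      map_zero' := le_antisymm (univNorm_le le_rfl fun π => by simp) (univNorm_nonneg _)
      add_le' := fun a b =>
        univNorm_le (add_nonneg (univNorm_nonneg a) (univNorm_nonneg b)) fun π => by
          rw [map_add]
          exact (norm_add_le _ _).trans (add_le_add (norm_eval_le π a) (norm_eval_le π b))
      neg' := fun a => by simp only [univNorm, map_neg, norm_neg] }

lemma norm_def (a : ConvAlg.{u} h) : ‖a‖ = ⨆ π : CovRep.{u} h, ‖π.eval a‖ := rfl

instance : NormedSpace ℂ (ConvAlg.{u} h) where
  norm_smul_le c a :=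
    univNorm_le (mul_nonneg (norm_nonneg _) (norm_nonneg _)) fun π => by
      rw [map_smul, norm_smul]
      exact mul_le_mul_of_nonneg_left (norm_eval_le π a) (norm_nonneg c)

instance : NonUnitalSeminormedRing (ConvAlg.{u} h) where
  __ : SeminormedAddCommGroup (ConvAlg.{u} h) := inferInstance
  __ : NonUnitalRing (ConvAlg.{u} h) := inferInstance
  norm_mul_le a b :=
    univNorm_le (mul_nonneg (norm_nonneg _) (norm_nonneg _)) fun π => by
      rw [π.eval_mul]
      exact (norm_mul_le _ _).trans (mul_le_mul (norm_eval_le π a) (norm_eval_le π b)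
        (norm_nonneg _) (univNorm_nonneg a))

instance : NormedStarGroup (ConvAlg.{u} h) where
  norm_star_le a := univNorm_le (norm_nonneg a) fun π => by
    rw [π.eval_star, norm_star]
    exact norm_eval_le π a

lemma norm_mul_self_le_star_mul (a : ConvAlg.{u} h) : ‖a‖ * ‖a‖ ≤ ‖star a * a‖ := by
  have h1 : ‖a‖ ≤ Real.sqrt ‖star a * a‖ := univNorm_le (Real.sqrt_nonneg _) fun π => by
    apply Real.le_sqrt_of_sq_le
    rw [sq, ← CStarRing.norm_star_mul_self, ← π.eval_star, ← π.eval_mul]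
    exact norm_eval_le π _
  calc ‖a‖ * ‖a‖ ≤ Real.sqrt ‖star a * a‖ * Real.sqrt ‖star a * a‖ :=
        mul_self_le_mul_self (norm_nonneg a) h1
    _ = ‖star a * a‖ := Real.mul_self_sqrt (norm_nonneg _)

end ConvAlg

/-- The crossed product C*-algebra `C₀(Y) ⋊ ℤ` for the automorphism `f ↦ f ∘ h` of `C₀(Y)`: the
completion of `*-alg{C₀(Y), U}` in the universal norm. -/
def CrossedProduct.{a, b} {Y : Type b} [TopologicalSpace Y] (h : Y ≃ₜ Y) : Type (max a b) :=
  UniformSpace.Completion (ConvAlg.{a, b} h)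

namespace CrossedProduct

open UniformSpace Function

variable {h : Y ≃ₜ Y}

instance : NormedAddCommGroup (CrossedProduct.{u} h) :=
  inferInstanceAs (NormedAddCommGroup (Completion (ConvAlg.{u} h)))

instance : NormedSpace ℂ (CrossedProduct.{u} h) :=
  inferInstanceAs (NormedSpace ℂ (Completion (ConvAlg.{u} h)))

instance : CompleteSpace (CrossedProduct.{u} h) :=
  inferInstanceAs (CompleteSpace (Completion (ConvAlg.{u} h)))

/-- The canonical map of `*-alg{C₀(Y), U}` into its completion. -/
def of (h : Y ≃ₜ Y) : ConvAlg.{u} h →ₗᵢ[ℂ] CrossedProduct.{u} h :=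
  Completion.toComplₗᵢ (𝕜 := ℂ) (E := ConvAlg.{u} h)

lemma isDenseInducing_of : IsDenseInducing (of.{u} h) :=
  Completion.isDenseInducing_coe (α := ConvAlg.{u} h)

lemma denseRange_of : DenseRange (of.{u} h) := isDenseInducing_of.dense

instance : Mul (CrossedProduct.{u} h) :=
  ⟨curry <| (isDenseInducing_of.prodMap isDenseInducing_of).extend
    (of.{u} h ∘ uncurry (· * ·))⟩

lemma of_mul (a b : ConvAlg.{u} h) : of h (a * b) = of h a * of h b :=
  ((isDenseInducing_of.prodMap isDenseInducing_of).extend_eq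
    ((of.{u} h).continuous.comp continuous_mul) (a, b)).symm

instance : ContinuousMul (CrossedProduct.{u} h) where
  continuous_mul := by
    let m := (AddMonoidHom.mul : ConvAlg.{u} h →+ ConvAlg.{u} h →+ ConvAlg.{u} h).compr₂
      (Completion.toCompl (α := ConvAlg.{u} h))
    have : Continuous fun p : ConvAlg.{u} h × ConvAlg.{u} h => m p.1 p.2 :=
      (Completion.continuous_coe (ConvAlg.{u} h)).comp continuous_mul
    have di : IsDenseInducing (Completion.toCompl : ConvAlg.{u} h → Completion (ConvAlg.{u} h)) :=
      Completion.isDenseInducing_coe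
    exact (di.extend_Z_bilin di this :)

instance : Star (CrossedProduct.{u} h) :=
  ⟨isDenseInducing_of.extend fun a : ConvAlg.{u} h => of h (star a)⟩

lemma of_star (a : ConvAlg.{u} h) : of h (star a) = star (of h a) :=
  (isDenseInducing_of.extend_eq ((of.{u} h).continuous.comp continuous_star) a).symm

instance : ContinuousStar (CrossedProduct.{u} h) where
  continuous_star := by
    have : UniformContinuous fun a : ConvAlg.{u} h => of h (star a) :=
      (of.{u} h).isometry.uniformContinuous.comp star_isometry.uniformContinuous
    exact uniformContinuous_uniformly_extend
      (Completion.isUniformInducing_coe (ConvAlg.{u} h)) isDenseInducing_of.dense this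
      |>.continuous

lemma ind₁ {p : CrossedProduct.{u} h → Prop} (hp : IsClosed {x | p x})
    (ih : ∀ a, p (of h a)) (x) : p x :=
  Completion.induction_on x hp ih

lemma ind₂ {p : CrossedProduct.{u} h → CrossedProduct.{u} h → Prop}
    (hp : IsClosed {x : CrossedProduct.{u} h × CrossedProduct.{u} h | p x.1 x.2})
    (ih : ∀ a b, p (of h a) (of h b)) (x y) : p x y :=
  Completion.induction_on₂ x y hp ih

lemma ind₃ {p : CrossedProduct.{u} h → CrossedProduct.{u} h → CrossedProduct.{u} h → Prop}
    (hp : IsClosed {x : CrossedProduct.{u} h × CrossedProduct.{u} h × CrossedProduct.{u} h |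
      p x.1 x.2.1 x.2.2})
    (ih : ∀ a b c, p (of h a) (of h b) (of h c)) (x y z) : p x y z :=
  Completion.induction_on₃ x y z hp ih

instance : NonUnitalRing (CrossedProduct.{u} h) where
  zero_mul := ind₁ (isClosed_eq (by fun_prop) (by fun_prop)) fun a => by
    rw [← map_zero (of.{u} h), ← of_mul, zero_mul]
  mul_zero := ind₁ (isClosed_eq (by fun_prop) (by fun_prop)) fun a => by
    rw [← map_zero (of.{u} h), ← of_mul, mul_zero]
  mul_assoc := ind₃ (isClosed_eq (by fun_prop) (by fun_prop)) fun a b c => by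
    simp only [← of_mul, mul_assoc]
  left_distrib := ind₃ (isClosed_eq (by fun_prop) (by fun_prop)) fun a b c => by
    simp only [← of_mul, ← map_add, mul_add]
  right_distrib := ind₃ (isClosed_eq (by fun_prop) (by fun_prop)) fun a b c => by
    simp only [← of_mul, ← map_add, add_mul]

instance : NonUnitalNormedRing (CrossedProduct.{u} h) where
  __ : NormedAddCommGroup (CrossedProduct.{u} h) := inferInstance
  __ : NonUnitalRing (CrossedProduct.{u} h) := inferInstance
  norm_mul_le := ind₂ (isClosed_le (by fun_prop) (by fun_prop)) fun a b => by
    simpa only [← of_mul, LinearIsometry.norm_map] using norm_mul_le a b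

instance : StarRing (CrossedProduct.{u} h) where
  star_involutive := ind₁ (isClosed_eq (by fun_prop) (by fun_prop)) fun a => by
    simp only [← of_star, star_star]
  star_add := ind₂ (isClosed_eq (by fun_prop) (by fun_prop)) fun a b => by
    simp only [← of_star, ← map_add, star_add]
  star_mul := ind₂ (isClosed_eq (by fun_prop) (by fun_prop)) fun a b => by
    simp only [← of_star, ← of_mul, star_mul]

instance : CStarRing (CrossedProduct.{u} h) where
  norm_mul_self_le := ind₁ (isClosed_le (by fun_prop) (by fun_prop)) fun a => by
    simpa only [← of_star, ← of_mul, LinearIsometry.norm_map] using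
      ConvAlg.norm_mul_self_le_star_mul a

instance : IsScalarTower ℂ (CrossedProduct.{u} h) (CrossedProduct.{u} h) where
  smul_assoc c x y := by
    refine ind₂ (p := fun x y => (c • x) * y = c • (x * y))
      (isClosed_eq ((continuous_fst.const_smul c).mul continuous_snd)
        ((continuous_fst.mul continuous_snd).const_smul c)) (fun a b => ?_) x y
    rw [← (of.{u} h).map_smul, ← of_mul, ← of_mul, ← (of.{u} h).map_smul, smul_mul_assoc]

instance : SMulCommClass ℂ (CrossedProduct.{u} h) (CrossedProduct.{u} h) where
  smul_comm c x y := by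
    refine ind₂ (p := fun x y => c • (x * y) = x * (c • y))
      (isClosed_eq ((continuous_fst.mul continuous_snd).const_smul c)
        (continuous_fst.mul (continuous_snd.const_smul c))) (fun a b => ?_) x y
    rw [← (of.{u} h).map_smul, ← of_mul, ← of_mul, ← (of.{u} h).map_smul, mul_smul_comm]

instance : StarModule ℂ (CrossedProduct.{u} h) where
  star_smul c x := by
    refine ind₁ (p := fun x => star (c • x) = star c • star x)
      (isClosed_eq (continuous_star.comp (continuous_id.const_smul c))
        (continuous_star.const_smul (star c))) (fun a => ?_) x
    rw [← (of.{u} h).map_smul, ← of_star, ← of_star, ← (of.{u} h).map_smul, star_smul]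

instance : NonUnitalCStarAlgebra (CrossedProduct.{u} h) where

/-- The element `f Uᵏ` of `C₀(Y) ⋊ ℤ`. -/
def mono (h : Y ≃ₜ Y) (k : ℤ) (f : C₀(Y, ℂ)) : CrossedProduct.{u} h :=
  of h (ConvAlg.mono h k f)

end CrossedProduct

end CrossedProduct

/-! ### `q`-invariant sets -/

/-- `Y` is `q`-invariant: `q Y = Y`. -/
def IsQInvariant (q : ℝ) (Y : Set ℝ) : Prop := (fun x => q * x) '' Y = Y

lemma IsQInvariant.mem_iff {q : ℝ} (hq : 0 < q) {Y : Set ℝ} (hY : IsQInvariant q Y) (x : ℝ) :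
    x ∈ Y ↔ q * x ∈ Y := by
  constructor
  · intro hx
    rw [← hY]
    exact ⟨x, hx, rfl⟩
  · intro hx
    rw [← hY] at hx
    obtain ⟨y, hy, hyx⟩ := hx
    rwa [← mul_left_cancel₀ hq.ne' hyx]

lemma IsQInvariant.diff_zero {q : ℝ} (hq : 0 < q) {Y : Set ℝ} (hY : IsQInvariant q Y) :
    IsQInvariant q (Y \ {0}) := by
  ext x
  constructor
  · rintro ⟨y, ⟨hy, hy0⟩, rfl⟩
    exact ⟨(hY.mem_iff hq y).1 hy, mul_ne_zero hq.ne' hy0⟩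
  · rintro ⟨hx, hx0⟩
    rw [← hY] at hx
    obtain ⟨y, hy, rfl⟩ := hx
    exact ⟨y, ⟨hy, fun h => hx0 (by rw [Set.mem_singleton_iff] at h ⊢; simp [h])⟩, rfl⟩

/-- The homeomorphism `x ↦ q x` of a `q`-invariant set. -/
def dilation {q : ℝ} (hq : 0 < q) {Y : Set ℝ} (hY : IsQInvariant q Y) : Y ≃ₜ Y :=
  (Homeomorph.mulLeft₀ q hq.ne').subtype (hY.mem_iff hq)

lemma dilation_apply {q : ℝ} (hq : 0 < q) {Y : Set ℝ} (hY : IsQInvariant q Y) (x : Y) :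
    (dilation hq hY x : ℝ) = q * x := rfl

/-- The isomorphism statement for one of the two crossed products: the norm closure `B` of the
finite sums `∑ fₖ(T) uᵏ`, `fₖ ∈ C₀(Y)`, is a `*`-subalgebra of the bounded operators, and
`f Uᵏ ↦ f(T) uᵏ` extends to a `*`-isomorphism of `C₀(Y) ⋊ ℤ` onto `B`. -/
def CrossedProductIsoClosure {H : Type u} [NormedAddCommGroup H] [InnerProductSpace ℂ H]
    [CompleteSpace H] (T : H →ₗ.[ℂ] H) (u : H →L[ℂ] H) {Y : Set ℝ} (h : Y ≃ₜ Y) : Prop :=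
  ∃ B : NonUnitalStarSubalgebra ℂ (H →L[ℂ] H),
    (B : Set (H →L[ℂ] H)) = closure (finiteSums T u Y) ∧
    ∃ Φ : CrossedProduct.{u} h ≃⋆ₐ[ℂ] B,
      ∀ (k : ℤ) (f : C₀(Y, ℂ)),
        ((Φ (CrossedProduct.mono h k f) : B) : H →L[ℂ] H) = funCalc₀ T f * opZPow u k

end QPlane

end

noncomputable section

namespace QPlane

/-! ### Isometric covariant representations -/

section Isometric

variable {Y : Type v} [TopologicalSpace Y] {h : Y ≃ₜ Y}

/-! The isomorphism rests on two facts: `u` and the functional calculus of `T = |ζ|` form a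
covariant representation, and this representation is isometric for the universal norm. Its extension
to the completion is then an isometric `*`-homomorphism, whose range is the closure of the finite
sums.

Covariance. Trivial kernel makes `u` unitary, and `ζ ζ* = q² ζ* ζ` becomes `u T² u* = q² T²`. With
the bounded resolvent `R = (T + 1)⁻¹` and `S = u R u*` this reads `q² S² (1 - R)² = (1 - S)² R²`.
Uniqueness of positive square roots, in the form `eq_cfc_rescale`, gives `S = (q T + 1)⁻¹`, whence
`u f(T) u* = f(q T)` (`funCalc₀_alpha`).

Isometry. Each nonzero point of `Y` carries a bump `g` whose proper translates under the dilation
group are disjoint from it. Compressing `π(∑ fₖ Uᵏ)` by `g` and a translate of `g` isolates a single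
`fₖ`, so `‖fₖ‖ ≤ ‖π(a)‖` (`norm_coeffs_le`); this uses that the spectrum of `T` is all of `X` and
that the nonzero points are dense in `Y`. Domination of coefficients implies isometry by a growth
argument (`norm_eval_eq`): for `b = a* a`, the power `b ^ 2 ^ n` has at most linearly many (in `2 ^
n`) nonzero coefficients, each bounded by `‖π(b)‖ ^ 2 ^ n`. So `‖b‖ ^ 2 ^ n` is at most a linear
factor times `‖π(b)‖ ^ 2 ^ n`, and taking roots removes the factor.

Existence. On `ℓ²(D)`, with `D` a countable `q`-invariant dense subset of `X \ {0}`, let `T` be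
multiplication by the coordinate and `u` the permutation induced by the dilation; then `ζ = u T`. -/

lemma le_of_pow_two_pow_le {x y K : ℝ} (hy : 0 ≤ y)
    (H : ∀ n : ℕ, x ^ 2 ^ n ≤ (K * 2 ^ n + 1) * y ^ 2 ^ n) : x ≤ y := by
  by_contra! hxy
  rcases hy.eq_or_lt with rfl | hy
  · have := H 0
    simp at this
    linarith
  have ht : 1 < x / y := (one_lt_div hy).2 hxy
  have h1 : ∀ n : ℕ, (x / y) ^ 2 ^ n ≤ K * 2 ^ n + 1 := fun n => by
    rw [div_pow, div_le_iff₀ (by positivity)]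
    exact H n
  -- An exponential with base `x / y > 1` outgrows every linear function, here along the exponents
  -- `2 ^ n`.
  have h2 := (tendsto_pow_const_div_const_pow_of_one_lt 1 ht).const_mul K
  have h3 := (tendsto_pow_const_div_const_pow_of_one_lt 0 ht)
  have h4 := (h2.add h3).comp (tendsto_pow_atTop_atTop_of_one_lt (α := ℕ) one_lt_two)
  simp only [mul_zero, add_zero] at h4
  obtain ⟨n, hn⟩ := (h4.eventually (gt_mem_nhds one_pos)).exists
  have hp : 0 < (x / y) ^ 2 ^ n := by positivity
  simp only [Function.comp_apply, pow_one, pow_zero, Nat.cast_pow, Nat.cast_ofNat] at hn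
  rw [mul_div_assoc', ← add_div, div_lt_one hp] at hn
  exact absurd (h1 n) (not_le.2 hn)

namespace ConvAlg

lemma coeffs_mono (n k : ℤ) (f : C₀(Y, ℂ)) :
    coeffs h (mono.{u} h n f) k = if n = k then f else 0 := by
  classical
  simp [mono, Finsupp.single_apply]

/-- The elements `∑ fₖ Uᵏ` with `fₖ = 0` for `|k| > L`. -/
def band (h : Y ≃ₜ Y) (L : ℕ) : Submodule ℂ (ConvAlg.{u} h) :=
  Submodule.span ℂ {a | ∃ (n : ℤ) (f : C₀(Y, ℂ)), |n| ≤ L ∧ a = mono.{u} h n f}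

lemma mul_mem_band {L M : ℕ} {a b : ConvAlg.{u} h} (ha : a ∈ band h L) (hb : b ∈ band h M) :
    a * b ∈ band h (L + M) := by
  have : Submodule.map₂ (mulBilin.{u} h) (band h L) (band h M) ≤ band h (L + M) := by
    rw [band, band, Submodule.map₂_span_span, Submodule.span_le]
    rintro _ ⟨_, ⟨n, f, hn, rfl⟩, _, ⟨m, g, hm, rfl⟩, rfl⟩
    change mono.{u} h n f * mono.{u} h m g ∈ band h (L + M)
    rw [mono_mul_mono]
    refine Submodule.subset_span ⟨_, _, ?_, rfl⟩
    push_cast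
    exact (abs_add_le n m).trans (add_le_add hn hm)
  exact this (Submodule.apply_mem_map₂ _ ha hb)

lemma exists_mem_band (a : ConvAlg.{u} h) : ∃ L, a ∈ band h L := by
  refine induction a ⟨0, zero_mem _⟩ (fun n f => ⟨n.natAbs, Submodule.subset_span
    ⟨n, f, (Int.natCast_natAbs n).ge, rfl⟩⟩) ?_
  rintro a b ⟨L, ha⟩ ⟨M, hb⟩
  have key : ∀ {L M : ℕ}, L ≤ M → band.{u} h L ≤ band h M := fun {L M} hLM =>
    Submodule.span_mono (by rintro _ ⟨n, f, hn, rfl⟩; exact ⟨n, f, by omega, rfl⟩)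
  exact ⟨max L M, add_mem (key (le_max_left _ _) ha) (key (le_max_right _ _) hb)⟩

lemma eq_sum_of_mem_band {L : ℕ} {a : ConvAlg.{u} h} (ha : a ∈ band h L) :
    a = ∑ k ∈ Finset.Icc (-(L : ℤ)) L, mono.{u} h k (coeffs h a k) := by
  refine Submodule.span_induction ?_ ?_ ?_ ?_ ha
  · rintro _ ⟨n, f, hn, rfl⟩
    rw [Finset.sum_eq_single n]
    · simp [coeffs_mono]
    · intro k _ hk
      simp [coeffs_mono, hk.symm]
    · intro hn'
      exact absurd (Finset.mem_Icc.2 (abs_le.1 hn)) hn'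
  · simp
  · intro a b _ _ ha hb
    conv_lhs => rw [ha, hb]
    simp [Finset.sum_add_distrib]
  · intro c a _ ha
    conv_lhs => rw [ha]
    simp [Finset.smul_sum]

lemma norm_mono_le (n : ℤ) (f : C₀(Y, ℂ)) : ‖mono.{u} h n f‖ ≤ ‖f‖ :=
  univNorm_le (norm_nonneg f) fun π => π.norm_eval_mono_le n f

/-- There are `2 L + 1` indices in the band, and each term has norm at most that of its coefficient.
This crude bound suffices because only its linear growth in `L` matters. -/
lemma norm_le_of_mem_band {L : ℕ} {a : ConvAlg.{u} h} (ha : a ∈ band h L) {C : ℝ}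
    (hC : ∀ k, ‖coeffs h a k‖ ≤ C) : ‖a‖ ≤ (2 * L + 1) * C := by
  conv_lhs => rw [eq_sum_of_mem_band ha]
  refine (norm_sum_le_of_le _ fun k _ => (norm_mono_le k _).trans (hC k)).trans ?_
  rw [Finset.sum_const, Int.card_Icc, nsmul_eq_mul]
  apply le_of_eq
  congr 1
  have : ((L : ℤ) + 1 - -(L : ℤ)).toNat = 2 * L + 1 := by omega
  rw [this]
  push_cast
  ring

end ConvAlg

namespace CovRep

open ConvAlg

variable (π : CovRep.{u} h)

/-- A covariant representation that dominates the coefficients is isometric for the universal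
norm. -/
theorem norm_eval_eq (hπ : ∀ a k, ‖coeffs h a k‖ ≤ ‖π.eval a‖) (a : ConvAlg.{u} h) :
    ‖π.eval a‖ = ‖a‖ := by
  refine le_antisymm (norm_eval_le π a) ?_
  obtain ⟨L, hL⟩ := exists_mem_band (star a * a)
  set b := star a * a with hb
  -- `c n` is `b ^ 2 ^ n`, formed by repeated squaring since the algebra has no unit. It stays
  -- self-adjoint, so the C*-inequality applies at each squaring.
  let c : ℕ → ConvAlg.{u} h := fun n => Nat.rec b (fun _ x => x * x) n
  have hc1 : ∀ n, c (n + 1) = c n * c n := fun n => rfl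
  have hstar : ∀ n, star (c n) = c n := by
    intro n
    induction n with
    | zero => exact (by simp [hb] : star b = b)
    | succ n ih => rw [hc1, star_mul, ih]
  have hnorm : ∀ n, ‖b‖ ^ 2 ^ n ≤ ‖c n‖ := by
    intro n
    induction n with
    | zero => exact (pow_one ‖b‖).le
    | succ n ih =>
      have h1 := norm_mul_self_le_star_mul (c n)
      rw [hstar] at h1
      rw [pow_succ, pow_mul, sq, hc1]
      exact (mul_self_le_mul_self (by positivity) ih).trans h1
  have heval : ∀ n, ‖π.eval (c n)‖ ≤ ‖π.eval b‖ ^ 2 ^ n := by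
    intro n
    induction n with
    | zero => exact (pow_one _).ge
    | succ n ih =>
      rw [hc1, π.eval_mul, pow_succ, pow_mul, sq]
      exact (norm_mul_le _ _).trans (mul_self_le_mul_self (norm_nonneg _) ih)
  have hband : ∀ n, c n ∈ band h (2 ^ n * L) := by
    intro n
    induction n with
    | zero =>
      rw [pow_zero, one_mul]
      exact hL
    | succ n ih =>
      have := mul_mem_band ih ih
      rwa [← hc1, ← two_mul, ← mul_assoc, ← pow_succ'] at this
  have hle : ‖b‖ ≤ ‖π.eval b‖ := by
    -- `c n` lies in the band of width `2 ^ n * L`, which has `2 * (2 ^ n * L) + 1` indices; hence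
    -- `K = 2 * L`.
    refine le_of_pow_two_pow_le (K := 2 * L) (norm_nonneg _) fun n => (hnorm n).trans ?_
    refine (norm_le_of_mem_band (hband n) fun k => (hπ _ k).trans (heval n)).trans (le_of_eq ?_)
    push_cast
    ring
  have h1 : ‖a‖ * ‖a‖ ≤ ‖π.eval a‖ * ‖π.eval a‖ := by
    refine (norm_mul_self_le_star_mul a).trans (hle.trans (le_of_eq ?_))
    rw [hb, π.eval_mul, π.eval_star, CStarRing.norm_star_mul_self]
  exact (mul_self_le_mul_self_iff (norm_nonneg _) (norm_nonneg _)).2 h1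

/-- Moving the right factor past `Vⁿ` turns the `n`-th term into `π(g fₙ αⁿ⁻ᵏ(g)) Vⁿ`, which
vanishes unless `n = k`. The compression thus plays the role of a coefficient projection. -/
lemma compress_eval {g : C₀(Y, ℂ)} (hg : ∀ j : ℤ, j ≠ 0 → g * alpha h j g = 0)
    (a : ConvAlg.{u} h) (k : ℤ) :
    π.rep g * π.eval a * π.rep (alpha h (-k) g) =
      π.rep (g * coeffs h a k * g) * ((π.V ^ k : unitary (π.H →L[ℂ] π.H)) : π.H →L[ℂ] π.H) := by
  refine ConvAlg.induction a ?_ (fun n f => ?_) (fun a b ha hb => ?_)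
  · simp
  · rw [eval_mono, mul_assoc, mul_assoc, π.covariant_zpow, alpha_alpha, ← mul_assoc, ← mul_assoc,
      ← map_mul, ← map_mul, coeffs_mono]
    split_ifs with hnk
    · rw [hnk, add_neg_cancel, alpha_id]
    · rw [mul_right_comm, hg _ (by omega), zero_mul, mul_zero, zero_mul, map_zero, zero_mul,
        zero_mul]
  · rw [map_add, mul_add, add_mul, ha, hb, map_add, Finsupp.add_apply, mul_add, add_mul, map_add,
      add_mul]

/-- A representation of `C₀(Y)` that is isometric on a dense set of points at which the action is
locally wandering dominates the coefficients. -/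
theorem norm_coeffs_le {S : Set Y} (hS : Dense S)
    (hrep : ∀ (f : C₀(Y, ℂ)), ∀ y ∈ S, ‖f y‖ ≤ ‖π.rep f‖)
    (hbump : ∀ y ∈ S, ∃ g : C₀(Y, ℂ), g y = 1 ∧ ‖g‖ ≤ 1 ∧ ∀ j : ℤ, j ≠ 0 → g * alpha h j g = 0)
    (a : ConvAlg.{u} h) (k : ℤ) : ‖coeffs h a k‖ ≤ ‖π.eval a‖ := by
  have hrep1 : ∀ f, ‖π.rep f‖ ≤ ‖f‖ := fun f => by
    let _ : NonUnitalCStarAlgebra C₀(Y, ℂ) := { }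
    exact NonUnitalStarAlgHom.norm_apply_le π.rep f
  have hpt : ∀ y ∈ S, ‖coeffs h a k y‖ ≤ ‖π.eval a‖ := by
    intro y hy
    obtain ⟨g, hgy, hg1, hg⟩ := hbump y hy
    have hg2 : ‖alpha h (-k) g‖ ≤ 1 := by
      refine le_trans ?_ hg1
      rw [← ZeroAtInftyContinuousMap.norm_toBCF_eq_norm]
      refine (BoundedContinuousFunction.norm_le (norm_nonneg _)).2 fun x => ?_
      rw [← ZeroAtInftyContinuousMap.norm_toBCF_eq_norm (f := g)]
      exact g.toBCF.norm_coe_le_norm _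
    have h1 := hrep (g * coeffs h a k * g) y hy
    have h2 : (g * coeffs h a k * g) y = coeffs h a k y := by simp [hgy]
    rw [h2] at h1
    refine h1.trans ?_
    have h3 := congrArg norm (π.compress_eval hg a k)
    rw [CStarRing.norm_mul_coe_unitary] at h3
    rw [← h3]
    calc _ ≤ ‖π.rep g‖ * ‖π.eval a‖ * ‖π.rep (alpha h (-k) g)‖ :=
          (norm_mul_le _ _).trans (mul_le_mul_of_nonneg_right (norm_mul_le _ _) (norm_nonneg _))
      _ ≤ 1 * ‖π.eval a‖ * 1 := by
          gcongr
          · exact (hrep1 g).trans hg1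
          · exact (hrep1 _).trans hg2
      _ = ‖π.eval a‖ := by ring
  rw [← ZeroAtInftyContinuousMap.norm_toBCF_eq_norm]
  refine (BoundedContinuousFunction.norm_le (norm_nonneg _)).2 fun y => ?_
  refine hS.induction (P := fun y => ‖coeffs h a k y‖ ≤ ‖π.eval a‖) hpt ?_ y
  exact isClosed_le (by fun_prop) continuous_const

/-- An isometric covariant representation identifies the crossed product with the norm closure of
the image of `*-alg{C₀(Y), U}`. -/
theorem exists_starAlgEquiv (hπ : ∀ a, ‖π.eval a‖ = ‖a‖) :
    ∃ B : NonUnitalStarSubalgebra ℂ (π.H →L[ℂ] π.H),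
      (B : Set (π.H →L[ℂ] π.H)) = closure (Set.range π.eval) ∧
      ∃ Φ : CrossedProduct.{u} h ≃⋆ₐ[ℂ] B, ∀ (k : ℤ) (f : C₀(Y, ℂ)),
        ((Φ (CrossedProduct.mono h k f) : B) : π.H →L[ℂ] π.H) =
          π.eval (ConvAlg.mono.{u} h k f) := by
  let E : ConvAlg.{u} h →L[ℂ] (π.H →L[ℂ] π.H) := π.eval.mkContinuous 1 fun a => by
    rw [hπ, one_mul]
  let F : CrossedProduct.{u} h →L[ℂ] (π.H →L[ℂ] π.H) :=
    E.extend (CrossedProduct.of.{u} h).toContinuousLinearMap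
  have hF : ∀ a, F (CrossedProduct.of h a) = π.eval a := fun a =>
    ContinuousLinearMap.extend_eq E CrossedProduct.denseRange_of
      (CrossedProduct.of.{u} h).isometry.isUniformInducing a
  have hFn : ∀ x, ‖F x‖ = ‖x‖ :=
    CrossedProduct.ind₁ (isClosed_eq (by fun_prop) (by fun_prop)) fun a => by
      rw [hF, hπ, LinearIsometry.norm_map]
  let G : CrossedProduct.{u} h →⋆ₙₐ[ℂ] (π.H →L[ℂ] π.H) :=
    { toFun := F
      map_smul' := fun c x => F.map_smul c x
      map_zero' := F.map_zero
      map_add' := F.map_add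
      map_mul' := CrossedProduct.ind₂ (isClosed_eq (by fun_prop) (by fun_prop)) fun a b => by
        rw [← CrossedProduct.of_mul, hF, hF, hF, π.eval_mul]
      map_star' := CrossedProduct.ind₁ (isClosed_eq (by fun_prop) (by fun_prop)) fun a => by
        rw [← CrossedProduct.of_star, hF, hF, π.eval_star] }
  have hiso : Isometry F := AddMonoidHomClass.isometry_of_norm F hFn
  have hinj : Function.Injective G := hiso.injective
  refine ⟨NonUnitalStarAlgHom.range G, ?_, StarAlgEquiv.ofInjective' G hinj, fun k f => ?_⟩
  · rw [NonUnitalStarAlgHom.coe_range]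
    change Set.range F = _
    have h1 : Set.range π.eval = F '' Set.range (CrossedProduct.of.{u} h) := by
      rw [← Set.range_comp]
      exact congrArg Set.range (funext fun a => (hF a).symm)
    -- An isometry out of a complete space is a closed embedding, so the closure of the image of the
    -- dense subalgebra is the whole range.
    rw [h1, hiso.isClosedEmbedding.closure_image_eq, CrossedProduct.denseRange_of.closure_range,
      Set.image_univ]
  · exact hF _

end CovRep

end Isometric

/-! ### Graphs of unbounded operators -/

section Graphs

variable {H : Type u} [NormedAddCommGroup H] [InnerProductSpace ℂ H]

/-- The operator identities include equality of domains. On graphs a product becomes a composition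
of relations, and the domain conditions need no separate treatment. -/
lemma mem_graph_iff_exists {T : H →ₗ.[ℂ] H} {x y : H} :
    (x, y) ∈ T.graph ↔ ∃ hx : x ∈ T.domain, T ⟨x, hx⟩ = y := by
  simp [LinearPMap.mem_graph_iff]

lemma mem_graph_opComp {A B : H →ₗ.[ℂ] H} {x z : H} :
    (x, z) ∈ (opComp A B).graph ↔ ∃ y, (x, y) ∈ B.graph ∧ (y, z) ∈ A.graph := by
  simp only [mem_graph_iff_exists]
  constructor
  · rintro ⟨⟨⟨⟨x', hx'⟩, hx1, rfl⟩, hx⟩, rfl⟩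
    exact ⟨_, ⟨hx, rfl⟩, hx1, rfl⟩
  · rintro ⟨y, ⟨hx, rfl⟩, hy, rfl⟩
    exact ⟨⟨⟨⟨x, hx⟩, hy, rfl⟩, hx⟩, rfl⟩

lemma mem_graph_compPMap {u : H →ₗ[ℂ] H} {T : H →ₗ.[ℂ] H} {x z : H} :
    (x, z) ∈ (u.compPMap T).graph ↔ ∃ y, (x, y) ∈ T.graph ∧ u y = z := by
  simp only [mem_graph_iff_exists]
  constructor
  · rintro ⟨hx, rfl⟩
    exact ⟨_, ⟨hx, rfl⟩, rfl⟩
  · rintro ⟨_, ⟨hx, rfl⟩, rfl⟩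
    exact ⟨hx, rfl⟩

lemma mem_graph_smul {c : ℂ} {T : H →ₗ.[ℂ] H} {x z : H} :
    (x, z) ∈ (c • T).graph ↔ ∃ y, (x, y) ∈ T.graph ∧ c • y = z := by
  simp only [mem_graph_iff_exists]
  constructor
  · rintro ⟨hx, rfl⟩
    exact ⟨_, ⟨hx, rfl⟩, rfl⟩
  · rintro ⟨_, ⟨hx, rfl⟩, rfl⟩
    exact ⟨hx, rfl⟩

lemma mem_graph_adjoint [CompleteSpace H] {T : H →ₗ.[ℂ] H} (hT : Dense (T.domain : Set H))
    {y w : H} : (y, w) ∈ T.adjoint.graph ↔ ∀ x v, (x, v) ∈ T.graph → ⟪v, y⟫_ℂ = ⟪x, w⟫_ℂ := by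
  rw [LinearPMap.adjoint_graph_eq_graph_adjoint hT, Submodule.mem_adjoint_iff]
  simp only [sub_eq_zero]

lemma isResolventAt_iff {T : H →ₗ.[ℂ] H} {z : ℂ} {S : H →L[ℂ] H} :
    IsResolventAt T z S ↔ (∀ x, (S x, x + z • S x) ∈ T.graph) ∧
      ∀ x y, (x, y) ∈ T.graph → S (y - z • x) = x := by
  simp only [mem_graph_iff_exists, IsResolventAt, sub_eq_iff_eq_add]
  refine and_congr Iff.rfl ⟨?_, fun h x => h _ _ ⟨x.2, rfl⟩⟩
  rintro h x _ ⟨hx, rfl⟩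
  exact h ⟨x, hx⟩

end Graphs

/-! ### The resolvent at `-1` -/

section Resolvent

variable {H : Type u} [NormedAddCommGroup H] [InnerProductSpace ℂ H]

lemma isResolventAt_opResolvent {T : H →ₗ.[ℂ] H} {z : ℂ} (hz : z ∉ opSpectrum T) :
    IsResolventAt T z (opResolvent T z) := by
  have h : ∃ S : H →L[ℂ] H, IsResolventAt T z S := not_not.1 hz
  rw [opResolvent, dif_pos h]
  exact h.choose_spec

variable {T : H →ₗ.[ℂ] H} {R : H →L[ℂ] H}

lemma IsResolventAt.mem_graph (hR : IsResolventAt T (-1) R) (x : H) : (R x, x - R x) ∈ T.graph := by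
  simpa [sub_eq_add_neg] using (isResolventAt_iff.1 hR).1 x

lemma IsResolventAt.apply_add (hR : IsResolventAt T (-1) R) {x y : H} (h : (x, y) ∈ T.graph) :
    R (y + x) = x := by
  simpa using (isResolventAt_iff.1 hR).2 x y h

/-- With `r = (z + 1)⁻¹` one has `r - R = r (T - z) R`. So the inverses determine each other: `(T -
z)⁻¹ = r R (r - R)⁻¹` and `(r - R)⁻¹ = r⁻¹ (1 + r⁻¹ (T - z)⁻¹)`. -/
lemma mem_spectrum_resolvent_iff (hR : IsResolventAt T (-1) R) {z : ℂ} (hz : z ≠ -1) :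
    (z + 1)⁻¹ ∈ spectrum ℂ R ↔ z ∈ opSpectrum T := by
  have hz' : z + 1 ≠ 0 := fun h => hz (eq_neg_of_add_eq_zero_left h)
  rw [← not_iff_not, spectrum.notMem_iff]
  simp only [opSpectrum, Set.mem_ofPred_eq, not_not]
  set r := (z + 1)⁻¹ with hr
  have hr0 : r ≠ 0 := inv_ne_zero hz'
  have hz1 : r⁻¹ = z + 1 := by rw [hr, inv_inv]
  constructor
  · intro hu
    obtain ⟨⟨A, Q, hAQ, hQA⟩, rfl : A = _⟩ := hu
    have hRQ : R * Q = Q * R := by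
      have h1 : Commute (algebraMap ℂ (H →L[ℂ] H) r - R) R :=
        (Algebra.commute_algebraMap_left r R).sub_left (Commute.refl R)
      calc R * Q = Q * (algebraMap ℂ (H →L[ℂ] H) r - R) * R * Q := by rw [hQA, one_mul]
        _ = Q * R * ((algebraMap ℂ (H →L[ℂ] H) r - R) * Q) := by
            rw [mul_assoc Q, h1.eq]; simp only [mul_assoc]
        _ = Q * R := by rw [hAQ, mul_one]
    refine ⟨r • (R * Q), isResolventAt_iff.2 ⟨fun x => ?_, fun x y hxy => ?_⟩⟩
    · have h1 := hR.mem_graph (r • Q x)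
      have h2 : r • Q x - R (Q x) = x := by
        simpa [Algebra.algebraMap_eq_smul_one] using DFunLike.congr_fun hAQ x
      convert h1 using 2
      · simp
      · have h3 : z * r = 1 - r := by
          rw [hr]; field_simp; ring
        have h4 : r • Q x = x + R (Q x) := sub_eq_iff_eq_add.1 h2
        change x + z • r • R (Q x) = r • Q x - R (r • Q x)
        rw [map_smul, h4, smul_smul, h3]
        module
    · have h1 := hR.apply_add hxy
      have h2 : Q (r • x) - Q (R x) = x := by
        simpa [Algebra.algebraMap_eq_smul_one] using DFunLike.congr_fun hQA x
      have h3 : y - z • x = (y + x) - r⁻¹ • x := by rw [hz1, add_smul, one_smul]; abel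
      rw [map_smul] at h2
      rw [h3, hRQ]
      change r • Q (R (y + x - r⁻¹ • x)) = x
      rw [map_sub, map_sub, h1, map_smul, map_smul, smul_sub, smul_smul, mul_inv_cancel₀ hr0,
        one_smul, h2]
  · rintro ⟨S, hS⟩
    rw [isResolventAt_iff] at hS
    have h1 : ∀ x, R x + r⁻¹ • R (S x) = S x := fun x => by
      have := hR.apply_add (hS.1 x)
      rw [hz1, add_smul, one_smul, ← map_smul, ← add_assoc, ← map_add, ← map_add]
      exact this
    have h2 : ∀ x, S x - r⁻¹ • S (R x) = R x := fun x => by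
      have := hS.2 _ _ (hR.mem_graph x)
      rw [hz1, add_smul, one_smul, ← map_smul, ← map_add, ← map_sub]
      convert this using 2
      abel
    refine ⟨⟨algebraMap ℂ (H →L[ℂ] H) r - R, r⁻¹ • (1 + r⁻¹ • S), ?_, ?_⟩, rfl⟩
    · ext x
      have h3 : r • r⁻¹ • (x + r⁻¹ • S x) - R (r⁻¹ • (x + r⁻¹ • S x)) = x := by
        rw [smul_smul, mul_inv_cancel₀ hr0, one_smul, map_smul, map_add, map_smul, h1 x,
          add_sub_cancel_right]
      simpa [Algebra.algebraMap_eq_smul_one] using h3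
    · ext x
      have h3 : r⁻¹ • ((r • x - R x) + r⁻¹ • S (r • x - R x)) = x := by
        rw [map_sub, map_smul, smul_sub r⁻¹ (r • S x), smul_smul, inv_mul_cancel₀ hr0, one_smul,
          h2 x, sub_add_cancel, smul_smul, inv_mul_cancel₀ hr0, one_smul]
      simpa [Algebra.algebraMap_eq_smul_one] using h3

lemma spectrum_resolvent_subset {X : Set ℝ} (hR : IsResolventAt T (-1) R)
    (hspec : opSpectrum T = (fun x : ℝ => (x : ℂ)) '' X) :
    spectrum ℂ R ⊆ insert 0 ((fun x : ℝ => ((x + 1 : ℂ))⁻¹) '' X) := by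
  intro r hr
  by_cases hr0 : r = 0
  · exact Or.inl hr0
  · right
    have h1 : r⁻¹ - 1 ≠ -1 := by simpa using hr0
    have h2 := (mem_spectrum_resolvent_iff hR h1).1 (by simpa using hr)
    rw [hspec] at h2
    obtain ⟨x, hx, hxr⟩ := h2
    exact ⟨x, hx, by simp only at hxr ⊢; rw [hxr]; simp⟩

variable [CompleteSpace H]

lemma IsResolventAt.isSelfAdjoint (hT : IsSelfAdjoint T) (hR : IsResolventAt T (-1) R) :
    IsSelfAdjoint R := by
  rw [ContinuousLinearMap.isSelfAdjoint_iff_isSymmetric]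
  intro x y
  have h1 : ∀ x v y w, (x, v) ∈ T.graph → (y, w) ∈ T.graph → ⟪v, y⟫_ℂ = ⟪x, w⟫_ℂ := by
    intro x v y w hx hy
    have hy' : (y, w) ∈ T.adjoint.graph := by rwa [LinearPMap.isSelfAdjoint_def.1 hT]
    exact (mem_graph_adjoint hT.dense_domain).1 hy' x v hx
  have h2 := h1 _ _ _ _ (hR.mem_graph x) (hR.mem_graph y)
  simp only [inner_sub_left, inner_sub_right] at h2
  simpa using h2.symm

end Resolvent

/-! ### The polar decomposition of a `q`-normal operator with trivial kernel -/

section Polar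

variable {H : Type u} [NormedAddCommGroup H] [InnerProductSpace ℂ H]
  {q : ℝ} {ζ T : H →ₗ.[ℂ] H} {u : H →L[ℂ] H}

lemma eq_zero_of_mem_graph_sq (hker : ∀ x : T.domain, T x = 0 → x = 0) {x : H}
    (hx : (x, 0) ∈ (opComp T T).graph) : x = 0 := by
  have key : ∀ y : H, (y, 0) ∈ T.graph → y = 0 := fun y hy => by
    obtain ⟨hy, h0⟩ := mem_graph_iff_exists.1 hy
    exact congrArg Subtype.val (hker _ h0)
  obtain ⟨y, hxy, hy⟩ := mem_graph_opComp.1 hx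
  rw [key y hy] at hxy
  exact key x hxy

variable [CompleteSpace H]

/-- A partial isometry is unitary once it and its adjoint are injective. The kernel of `u` is that
of `ζ`, hence lies in that of `T² = ζ* ζ`. The kernel of `u*` lies in that of `ζ*`, because `ζ = u
T`, hence in that of `ζ ζ* = q² T²`. Both are trivial. -/
theorem IsPolarDecomposition.mem_unitary (hq : 0 < q) (hζ : IsQNormal q ζ)
    (hp : IsPolarDecomposition ζ u T) (hker : ∀ x : T.domain, T x = 0 → x = 0) :
    u ∈ unitary (H →L[ℂ] H) := by
  have hinj : ∀ x, u x = 0 → x = 0 := fun x hx => by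
    obtain ⟨hx1, hx2⟩ := (hp.ker_eq x).1 hx
    refine eq_zero_of_mem_graph_sq hker ?_
    rw [hp.modulus.sq, mem_graph_opComp]
    exact ⟨0, mem_graph_iff_exists.2 ⟨hx1, hx2⟩, Submodule.zero_mem _⟩
  have hinj' : ∀ x, (star u) x = 0 → x = 0 := fun x hx => by
    have h1 : (x, 0) ∈ ζ.adjoint.graph := by
      rw [mem_graph_adjoint hζ.dense_domain]
      intro y v hv
      rw [hp.eq_comp, mem_graph_compPMap] at hv
      obtain ⟨w, -, rfl⟩ := hv
      rw [inner_zero_right]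
      change ⟪u w, x⟫_ℂ = 0
      rw [← ContinuousLinearMap.adjoint_inner_right, ← ContinuousLinearMap.star_eq_adjoint, hx,
        inner_zero_right]
    have h2 : (x, 0) ∈ (opComp ζ ζ.adjoint).graph :=
      mem_graph_opComp.2 ⟨0, h1, Submodule.zero_mem _⟩
    rw [hζ.comm, mem_graph_smul, ← hp.modulus.sq] at h2
    obtain ⟨y, hy, hy0⟩ := h2
    have hq2 : (q : ℂ) ^ 2 ≠ 0 := pow_ne_zero _ (Complex.ofReal_ne_zero.2 hq.ne')
    rw [(smul_eq_zero.1 hy0).resolve_left hq2] at hy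
    exact eq_zero_of_mem_graph_sq hker hy
  have hpi := hp.partialIsometry
  have hpi' : star u * u * star u = star u := by
    have := congrArg star hpi
    simpa [mul_assoc] using this
  rw [Unitary.mem_iff]
  constructor
  · ext x
    have := hinj ((star u * u) x - x) (by
      rw [map_sub, sub_eq_zero]
      exact DFunLike.congr_fun (f := u * star u * u) (g := u) hpi x)
    exact sub_eq_zero.1 this
  · ext x
    have := hinj' ((u * star u) x - x) (by
      rw [map_sub, sub_eq_zero]
      exact DFunLike.congr_fun (f := star u * u * star u) (g := star u) hpi' x)
    exact sub_eq_zero.1 this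

/-- Since `ζ = u T` with `T` self-adjoint, a vector `x` in the domain of `ζ*` has `u* x` in that of
`T`, with `ζ* x = T u* x`. Thus `ζ ζ* = q² T²` yields `u T² u* x = q² T² x`, and `u*` is applied to
both sides. -/
lemma IsPolarDecomposition.sq_covariant (hζ : IsQNormal q ζ) (hp : IsPolarDecomposition ζ u T)
    {x w : H} (hx : (x, w) ∈ (opComp T T).graph) (hu : u ∈ unitary (H →L[ℂ] H)) :
    (star u x, (q : ℂ) ^ 2 • star u w) ∈ (opComp T T).graph := by
  have h1 : (x, (q : ℂ) ^ 2 • w) ∈ (opComp ζ ζ.adjoint).graph := by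
    rw [hζ.comm, mem_graph_smul, ← hp.modulus.sq]
    exact ⟨w, hx, rfl⟩
  obtain ⟨y, hxy, hy⟩ := mem_graph_opComp.1 h1
  rw [hp.eq_comp, mem_graph_compPMap] at hy
  obtain ⟨v, hyv, hv⟩ := hy
  refine mem_graph_opComp.2 ⟨y, ?_, ?_⟩
  · rw [← LinearPMap.isSelfAdjoint_def.1 hp.modulus.isSelfAdjoint,
      mem_graph_adjoint hp.modulus.isSelfAdjoint.dense_domain]
    intro a b hab
    rw [mem_graph_adjoint hζ.dense_domain] at hxy
    rw [← hxy a (u b) (by rw [hp.eq_comp, mem_graph_compPMap]; exact ⟨b, hab, rfl⟩),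
      ContinuousLinearMap.star_eq_adjoint, ContinuousLinearMap.adjoint_inner_right]
  · rw [← map_smul, ← hv]
    have : star u (u v) = v := DFunLike.congr_fun (Unitary.star_mul_self_of_mem hu) v
    change (y, star u (u v)) ∈ _
    rwa [this]

/-- Formally `T² = (1 - R)² R⁻²`, and clearing inverses in `u T² u* = q² T²` gives a relation
between bounded operators only. -/
lemma IsPolarDecomposition.resolvent_sq (hζ : IsQNormal q ζ) (hp : IsPolarDecomposition ζ u T)
    (hu : u ∈ unitary (H →L[ℂ] H)) {R : H →L[ℂ] H} (hR : IsResolventAt T (-1) R) :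
    (q : ℂ) ^ 2 • ((u * R * star u) ^ 2 * (1 - R) ^ 2) = (1 - u * R * star u) ^ 2 * R ^ 2 := by
  have hsq : ∀ y v, (y, v) ∈ (opComp T T).graph → R (R v) = ((1 - R) ^ 2 : H →L[ℂ] H) y := by
    intro y v hyv
    obtain ⟨t, hyt, htv⟩ := mem_graph_opComp.1 hyv
    have h1 := hR.apply_add hyt
    have h2 := hR.apply_add htv
    rw [map_add] at h1 h2
    have h3 : R v = t - R t := eq_sub_of_add_eq h2
    have h4 : R t = y - R y := eq_sub_of_add_eq h1
    rw [h3, map_sub, h4, sq]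
    simp
  have hgr : ∀ w, (R (R w), ((1 - R) ^ 2 : H →L[ℂ] H) w) ∈ (opComp T T).graph := by
    intro w
    refine mem_graph_opComp.2 ⟨R w - R (R w), hR.mem_graph _, ?_⟩
    have := hR.mem_graph (w - R w)
    rw [map_sub] at this
    convert this using 2
    simp [sq]
  have hsu : star u * u = 1 := Unitary.star_mul_self_of_mem hu
  have huu : u * star u = 1 := Unitary.mul_star_self_of_mem hu
  -- `hgr` is `T² R² = (1 - R)²` and `hsq` is `R² T² = (1 - R)²` on the domain of `T²`; the
  -- covariance of `T²` under `u*` is inserted between them.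
  have key : (q : ℂ) ^ 2 • (R ^ 2 * star u * (1 - R) ^ 2) = (1 - R) ^ 2 * star u * R ^ 2 := by
    ext w
    have := hsq _ _ (hp.sq_covariant hζ (hgr w) hu)
    rw [map_smul, map_smul] at this
    simpa [sq, mul_assoc] using this
  have h1 : (u * R * star u) ^ 2 = u * R ^ 2 * star u := by
    rw [sq, sq]
    calc _ = u * R * (star u * u) * R * star u := by simp only [mul_assoc]
      _ = _ := by rw [hsu, mul_one]; simp only [mul_assoc]
  have h2 : (1 - u * R * star u) ^ 2 = u * (1 - R) ^ 2 * star u := by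
    have : 1 - u * R * star u = u * (1 - R) * star u := by
      rw [mul_sub, sub_mul, mul_one, huu]
    rw [this, sq, sq]
    calc _ = u * (1 - R) * (star u * u) * (1 - R) * star u := by simp only [mul_assoc]
      _ = _ := by rw [hsu, mul_one]; simp only [mul_assoc]
  rw [h1, h2]
  have := congrArg (u * ·) key
  simpa only [mul_smul_comm, mul_assoc] using this

end Polar

/-! ### Rescaling the resolvent -/

section Rescale

/-- The map `r ↦ (q t + 1)⁻¹`, where `r = (t + 1)⁻¹`. -/
def rescale (q : ℝ) (r : ℂ) : ℂ := r / (q * (1 - r) + r)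

/-- The map `r ↦ (q² t² + 1)⁻¹`, where `r = (t + 1)⁻¹`. -/
def sqResolvent (q : ℝ) (r : ℂ) : ℂ := r ^ 2 / (q ^ 2 * (1 - r) ^ 2 + r ^ 2)

/-- The map `(t² + 1)⁻¹ ↦ (t + 1)⁻¹` for `t ≥ 0`. -/
def sqrtResolvent (s : ℂ) : ℂ := ((√s.re / (√s.re + √(1 - s.re)) : ℝ) : ℂ)

/-- Since `√` vanishes on negative reals, this holds for every real `s`, and `sqrtResolvent` is
continuous on all of `ℂ`. -/
lemma sqrt_add_sqrt_one_sub_pos (s : ℝ) : 0 < √s + √(1 - s) := by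
  rcases le_or_gt s 0 with hs | hs
  · exact add_pos_of_nonneg_of_pos (Real.sqrt_nonneg _) (Real.sqrt_pos.2 (by linarith))
  · exact add_pos_of_pos_of_nonneg (Real.sqrt_pos.2 hs) (Real.sqrt_nonneg _)

lemma continuous_sqrtResolvent : Continuous sqrtResolvent := by
  refine Complex.continuous_ofReal.comp (Continuous.div ?_ ?_ fun s =>
    (sqrt_add_sqrt_one_sub_pos s.re).ne')
  · exact Real.continuous_sqrt.comp Complex.continuous_re
  · exact (Real.continuous_sqrt.comp Complex.continuous_re).add
      (Real.continuous_sqrt.comp (continuous_const.sub Complex.continuous_re))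

variable {q ρ : ℝ}

lemma sq_denom_pos (hq : 0 < q) (h1 : ρ ≤ 1) :
    0 < q ^ 2 * (1 - ρ) ^ 2 + ρ ^ 2 := by
  rcases h1.eq_or_lt with rfl | h1
  · simp
  · have : 0 < 1 - ρ := by linarith
    positivity

lemma denom_pos (hq : 0 < q) (h0 : 0 ≤ ρ) (h1 : ρ ≤ 1) : 0 < q * (1 - ρ) + ρ := by
  rcases h1.eq_or_lt with rfl | h1
  · simp
  · have : 0 < 1 - ρ := by linarith
    positivity

lemma sqrtResolvent_sqResolvent (hq : 0 < q) (h0 : 0 ≤ ρ) (h1 : ρ ≤ 1) :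
    sqrtResolvent (sqResolvent q ρ) = rescale q ρ := by
  have hd := sq_denom_pos hq h1
  have hd' := denom_pos hq h0 h1
  set D := q ^ 2 * (1 - ρ) ^ 2 + ρ ^ 2 with hD
  have e1 : sqResolvent q ρ = ((ρ ^ 2 / D : ℝ) : ℂ) := by
    simp [sqResolvent, hD]
  have e2 : 1 - ρ ^ 2 / D = (q * (1 - ρ)) ^ 2 / D := by
    field_simp
    rw [hD]
    ring
  have h1' : 0 ≤ q * (1 - ρ) := mul_nonneg hq.le (by linarith)
  have hs : 0 < √D := Real.sqrt_pos.2 hd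
  rw [sqrtResolvent, e1, Complex.ofReal_re, e2, Real.sqrt_div (sq_nonneg _),
    Real.sqrt_div (sq_nonneg _), Real.sqrt_sq h0, Real.sqrt_sq h1', ← add_div,
    div_div_div_cancel_right₀ hs.ne', rescale, add_comm]
  push_cast
  rfl

variable {A : Type*} [CStarAlgebra A]

/-- `q² S² (1 - R)² = (1 - S)² R²` determines `S` as a function of `R`: up to the change of
variables `r = (t + 1)⁻¹` this is the uniqueness of the positive square root of `q² t²`. -/
theorem eq_cfc_rescale (hq : 0 < q) {R S : A} (hR : IsStarNormal R) (hS : IsStarNormal S)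
    (hRs : spectrum ℂ R ⊆ (fun x : ℝ => (x : ℂ)) '' Set.Icc 0 1)
    (hSs : spectrum ℂ S ⊆ (fun x : ℝ => (x : ℂ)) '' Set.Icc 0 1)
    (h : (q : ℂ) ^ 2 • (S ^ 2 * (1 - R) ^ 2) = (1 - S) ^ 2 * R ^ 2) : S = cfc (rescale q) R := by
  -- Used twice: for `R` with `p = q` and for `S` with `p = 1`, where `rescale 1` is the identity.
  have aux : ∀ {p : ℝ} {B : A}, 0 < p → IsStarNormal B →
      spectrum ℂ B ⊆ (fun x : ℝ => (x : ℂ)) '' Set.Icc 0 1 →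
      IsUnit ((p : ℂ) ^ 2 • (1 - B) ^ 2 + B ^ 2) ∧
      cfc (sqResolvent p) B * ((p : ℂ) ^ 2 • (1 - B) ^ 2 + B ^ 2) = B ^ 2 ∧
      ((p : ℂ) ^ 2 • (1 - B) ^ 2 + B ^ 2) * cfc (sqResolvent p) B = B ^ 2 ∧
      cfc sqrtResolvent (cfc (sqResolvent p) B) = cfc (rescale p) B := by
    intro p B hp hB hBs
    have hne : ∀ r ∈ spectrum ℂ B, (p : ℂ) ^ 2 * (1 - r) ^ 2 + r ^ 2 ≠ 0 := by
      intro r hr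
      obtain ⟨ρ, hρ, rfl⟩ := hBs hr
      have := (sq_denom_pos hp hρ.2).ne'
      beta_reduce
      exact_mod_cast this
    have hc : ContinuousOn (sqResolvent p) (spectrum ℂ B) :=
      ContinuousOn.div (by fun_prop) (by fun_prop) hne
    have hcfc : (p : ℂ) ^ 2 • (1 - B) ^ 2 + B ^ 2 =
        cfc (fun r : ℂ => (p : ℂ) ^ 2 * (1 - r) ^ 2 + r ^ 2) B := by
      rw [cfc_add B _ _ (by fun_prop) (by fun_prop), cfc_const_mul .., cfc_pow .., cfc_sub .., cfc_const_one ..,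
        cfc_pow .., cfc_id' ..]
    have hmul : cfc (sqResolvent p) B * ((p : ℂ) ^ 2 • (1 - B) ^ 2 + B ^ 2) = B ^ 2 := by
      rw [hcfc, ← cfc_mul _ _ _ hc, ← cfc_pow_id (R := ℂ) B 2]
      exact cfc_congr fun r hr => div_mul_cancel₀ _ (hne r hr)
    refine ⟨?_, hmul, ?_, ?_⟩
    · rw [hcfc]
      exact (isUnit_cfc_iff _ B).2 hne
    · conv_rhs => rw [← hmul]
      rw [hcfc]
      exact (cfc_commute_cfc _ _ B).eq
    · rw [← cfc_comp _ _ B hB continuous_sqrtResolvent.continuousOn hc]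
      refine cfc_congr fun r hr => ?_
      obtain ⟨ρ, hρ, rfl⟩ := hBs hr
      exact sqrtResolvent_sqResolvent hp hρ.1 hρ.2
  obtain ⟨hu, hmul, -, hsq⟩ := aux hq hR hRs
  obtain ⟨hu', -, hmul', hsq'⟩ := aux one_pos hS hSs
  have hid : cfc (rescale 1) S = S := by
    conv_rhs => rw [← cfc_id' ℂ S hS]
    exact cfc_congr fun r _ => by simp [rescale]
  simp only [Complex.ofReal_one, one_pow, one_smul] at hu' hmul'
  -- This is `S² / ((1 - S)² + S²) = R² / (q² (1 - R)² + R²)`. Multiplying by the denominator in `S`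
  -- on the left and the one in `R` on the right reduces it to `h` plus the common term `S² R²`, so
  -- commutation of `R` and `S` is never needed.
  have key : cfc (sqResolvent 1) S = cfc (sqResolvent q) R := by
    apply hu'.mul_left_cancel
    apply hu.mul_right_cancel
    rw [hmul', mul_assoc, hmul, mul_add, add_mul, mul_smul_comm, h]
  rw [← hsq, ← key, hsq', hid]

end Rescale

/-! ### The functional calculus as a covariant representation -/

section FunCalc

open Filter Topology

/-- The function `r ↦ f(t)`, `r = (t + 1)⁻¹`, with value `0` at `r = 0`. -/
def compactify (f : ℝ → ℂ) (r : ℂ) : ℂ := if r = 0 then 0 else f (r⁻¹ - 1).re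

open Classical in
/-- The extension by zero of a function in `C₀(Y)`. -/
def extendZero {Y : Set ℝ} (f : C₀(Y, ℂ)) (t : ℝ) : ℂ := if ht : t ∈ Y then f ⟨t, ht⟩ else 0

/-- The range of `t ↦ (t + 1)⁻¹` on `X ∪ {∞}`. -/
def invImage (X : Set ℝ) : Set ℂ := insert 0 ((fun x : ℝ => ((x + 1 : ℂ))⁻¹) '' X)

lemma compactify_inv (f : ℝ → ℂ) {x : ℝ} (hx : 0 ≤ x) : compactify f ((x + 1 : ℂ)⁻¹) = f x := by
  have : (x + 1 : ℂ) ≠ 0 := by exact_mod_cast (by positivity : x + 1 ≠ 0)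
  simp [compactify, this]

/-- Points of `invImage X` near `0` other than `0` itself come from large `x`, so continuity at `0`
is decay of `f` at infinity. Elsewhere `r ↦ r⁻¹ - 1` is continuous. -/
lemma continuousOn_compactify {X : Set ℝ} (hX : X ⊆ Set.Ici 0) {f : ℝ → ℂ}
    (hf : ContinuousOn f X) (hinf : ∀ ε > 0, ∃ M, ∀ x ∈ X, M < x → ‖f x‖ < ε) :
    ContinuousOn (compactify f) (invImage X) := by
  intro r hr
  rcases eq_or_ne r 0 with rfl | hr0
  · rw [ContinuousWithinAt, Metric.tendsto_nhds]
    intro ε hε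
    obtain ⟨M, hM⟩ := hinf ε hε
    have hM1 : 0 < (|M| + 1)⁻¹ := by positivity
    filter_upwards [self_mem_nhdsWithin, mem_nhdsWithin_of_mem_nhds (Metric.ball_mem_nhds 0 hM1)]
      with s hs hsM
    have h0 : compactify f 0 = 0 := by simp [compactify]
    rw [h0, dist_zero_right]
    rcases hs with rfl | ⟨x, hx, rfl⟩
    · simpa [h0] using hε
    · simp only
      rw [compactify_inv f (hX hx)]
      apply hM x hx
      have hx0 : 0 ≤ x := hX hx
      have h1 : ‖((x + 1 : ℂ))⁻¹‖ = (x + 1)⁻¹ := by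
        rw [norm_inv, ← Complex.ofReal_one, ← Complex.ofReal_add, Complex.norm_real,
          Real.norm_of_nonneg (by positivity)]
      rw [Metric.mem_ball, dist_zero_right, h1, inv_lt_inv₀ (by positivity) (by positivity)] at hsM
      linarith [le_abs_self M]
  · have h1 : ContinuousWithinAt (fun r : ℂ => f (r⁻¹ - 1).re) (invImage X \ {0}) r := by
      have hr' : r ∈ invImage X \ {0} := ⟨hr, hr0⟩
      have hmaps : Set.MapsTo (fun r : ℂ => (r⁻¹ - 1).re) (invImage X \ {0}) X := by
        rintro _ ⟨rfl | ⟨x, hx, rfl⟩, h0⟩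
        · exact absurd rfl h0
        · simpa using hx
      have hc : ContinuousWithinAt (fun r : ℂ => (r⁻¹ - 1).re) (invImage X \ {0}) r :=
        ((Complex.continuous_re.continuousAt).comp
          ((continuousAt_inv₀ hr0).sub continuousAt_const)).continuousWithinAt
      exact ContinuousWithinAt.comp (t := X) (hf _ (hmaps hr')) hc hmaps
    have h2 : {0}ᶜ ∈ 𝓝 r := isOpen_compl_singleton.mem_nhds hr0
    rw [Set.sdiff_eq, continuousWithinAt_inter h2] at h1
    refine h1.congr_of_eventuallyEq ?_ (by simp [compactify, hr0])
    filter_upwards [mem_nhdsWithin_of_mem_nhds h2] with s hs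
    have hs0 : s ≠ 0 := hs
    simp [compactify, hs0]

variable {X Y : Set ℝ}

lemma exists_compact_extendZero_lt (f : C₀(Y, ℂ)) {ε : ℝ} (hε : 0 < ε) :
    ∃ K : Set ℝ, IsCompact K ∧ K ⊆ Y ∧ ∀ x ∉ K, ‖extendZero f x‖ < ε := by
  have h1 := f.zero_at_infty'.eventually (Metric.ball_mem_nhds 0 hε)
  obtain ⟨K, hK, hKs⟩ := mem_cocompact.1 h1
  refine ⟨Subtype.val '' K, hK.image continuous_subtype_val, ?_, fun x hx => ?_⟩
  · rintro _ ⟨y, -, rfl⟩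
    exact y.2
  · rw [extendZero]
    split_ifs with hxY
    · have h2 : (⟨x, hxY⟩ : Y) ∈ Kᶜ := fun h => hx ⟨_, h, rfl⟩
      have h3 := hKs h2
      simpa using h3
    · simpa using hε

/-- Only `0` can be a point of `X` outside `Y`. The compact set off which `‖f‖ < ε` lies in `Y` and
so stays away from that point, where the value `0` is therefore the limit. -/
lemma continuousOn_extendZero (hXY : X \ {0} ⊆ Y) (f : C₀(Y, ℂ)) :
    ContinuousOn (extendZero f) X := by
  intro x hx
  by_cases hxY : x ∈ Y
  · have h1 : ContinuousOn (extendZero f) Y := by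
      rw [continuousOn_iff_continuous_domRestrict]
      convert f.continuous using 1
      ext y
      simp [extendZero]
    have h2 : Y ∈ 𝓝[X] x := by
      by_cases h0 : (0 : ℝ) ∈ Y
      · refine mem_of_superset self_mem_nhdsWithin fun y hy => ?_
        by_cases hy0 : y = 0
        · rwa [hy0]
        · exact hXY ⟨hy, hy0⟩
      · have hx0 : x ≠ 0 := fun h => h0 (h ▸ hxY)
        filter_upwards [self_mem_nhdsWithin,
          mem_nhdsWithin_of_mem_nhds (isOpen_compl_singleton.mem_nhds hx0)] with y hy hy0
        exact hXY ⟨hy, hy0⟩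
    exact (h1 x hxY).mono_of_mem_nhdsWithin h2
  · rw [ContinuousWithinAt, Metric.tendsto_nhds]
    intro ε hε
    obtain ⟨K, hK, hKY, hKε⟩ := exists_compact_extendZero_lt f hε
    filter_upwards [mem_nhdsWithin_of_mem_nhds
      (hK.isClosed.isOpen_compl.mem_nhds fun h => hxY (hKY h))] with y hy
    have : extendZero f x = 0 := by simp [extendZero, hxY]
    rw [this, dist_zero_right]
    exact hKε y hy

lemma continuousOn_compactify_extendZero (hX : X ⊆ Set.Ici 0) (hXY : X \ {0} ⊆ Y)
    (f : C₀(Y, ℂ)) : ContinuousOn (compactify (extendZero f)) (invImage X) := by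
  refine continuousOn_compactify hX (continuousOn_extendZero hXY f) fun ε hε => ?_
  obtain ⟨K, hK, -, hKε⟩ := exists_compact_extendZero_lt f hε
  obtain ⟨M, hM⟩ := hK.bddAbove
  exact ⟨M, fun x _ hx => hKε x fun h => (hM h).not_gt hx⟩

variable {H : Type u} [NormedAddCommGroup H] [InnerProductSpace ℂ H] [CompleteSpace H]
  {T : H →ₗ.[ℂ] H}

lemma funCalc₀_eq (T : H →ₗ.[ℂ] H) (f : C₀(Y, ℂ)) :
    funCalc₀ T f = cfc (compactify (extendZero f)) (opResolvent T (-1)) := rfl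

/-- The functional calculus of `T` as a representation of `C₀(Y)`. -/
def funCalcHom (hX : X ⊆ Set.Ici 0) (hXY : X \ {0} ⊆ Y)
    (hs : spectrum ℂ (opResolvent T (-1)) ⊆ invImage X) : C₀(Y, ℂ) →⋆ₙₐ[ℂ] (H →L[ℂ] H) :=
  have hc : ∀ f : C₀(Y, ℂ), ContinuousOn (compactify (extendZero f))
      (spectrum ℂ (opResolvent T (-1))) := fun f =>
    (continuousOn_compactify_extendZero hX hXY f).mono hs
  { toFun := fun f => funCalc₀ T f
    map_smul' := fun c f => by
      simp only [funCalc₀_eq]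
      rw [MonoidHom.id_apply, ← cfc_smul _ _ _ (hc f)]
      congr 1
      ext r
      simp only [compactify, extendZero]
      split_ifs <;> simp
    map_zero' := by
      rw [funCalc₀_eq, ← cfc_const_zero ℂ (opResolvent T (-1))]
      congr 1
      ext r
      simp [compactify, extendZero]
    map_add' := fun f g => by
      simp only [funCalc₀_eq]
      rw [← cfc_add _ _ _ (hc f) (hc g)]
      congr 1
      ext r
      simp only [compactify, extendZero]
      split_ifs <;> simp
    map_mul' := fun f g => by
      simp only [funCalc₀_eq]
      rw [← cfc_mul _ _ _ (hc f) (hc g)]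
      congr 1
      ext r
      simp only [compactify, extendZero]
      split_ifs <;> simp
    map_star' := fun f => by
      simp only [funCalc₀_eq]
      rw [← cfc_star]
      congr 1
      ext r
      simp only [compactify, extendZero]
      split_ifs <;> simp }

lemma zpow_dilation_apply {q : ℝ} (hq : 0 < q) (hY : IsQInvariant q Y) (n : ℤ) (y : Y) :
    (((dilation hq hY) ^ n) y : ℝ) = q ^ n * y := by
  induction n using Int.induction_on generalizing y with
  | zero => simp
  | succ n ih =>
    rw [zpow_add_one]
    change (((dilation hq hY) ^ (n : ℤ)) (dilation hq hY y) : ℝ) = _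
    rw [ih, dilation_apply, zpow_add_one₀ hq.ne', mul_assoc]
  | pred n ih =>
    rw [zpow_sub_one]
    change (((dilation hq hY) ^ (-n : ℤ)) ((dilation hq hY).symm y) : ℝ) = _
    rw [ih, zpow_sub_one₀ hq.ne', mul_assoc]
    rfl

lemma extendZero_alpha {q : ℝ} (hq : 0 < q) (hY : IsQInvariant q Y) (f : C₀(Y, ℂ)) (x : ℝ) :
    extendZero (alpha (dilation hq hY) 1 f) x = extendZero f (q * x) := by
  by_cases hx : x ∈ Y
  · have hx' := (hY.mem_iff hq x).1 hx
    simp only [extendZero, dif_pos hx, dif_pos hx']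
    rw [alpha_apply, zpow_one]
    rfl
  · have hx' := mt (hY.mem_iff hq x).2 hx
    simp only [extendZero, dif_neg hx, dif_neg hx']

lemma rescale_inv {q x : ℝ} (hq : 0 < q) (hx : 0 ≤ x) :
    rescale q ((x + 1 : ℂ)⁻¹) = (((q * x : ℝ) : ℂ) + 1)⁻¹ := by
  have h1 : (x + 1 : ℂ) ≠ 0 := by exact_mod_cast (by positivity : x + 1 ≠ 0)
  have h2 : (q * x + 1 : ℂ) ≠ 0 := by exact_mod_cast (by positivity : q * x + 1 ≠ 0)
  rw [rescale]
  have h3 : (q : ℂ) * (1 - (x + 1 : ℂ)⁻¹) + (x + 1 : ℂ)⁻¹ = (q * x + 1) * (x + 1 : ℂ)⁻¹ := by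
    field_simp
    ring
  rw [h3]
  push_cast
  field_simp

lemma invImage_subset_Icc (hX : X ⊆ Set.Ici 0) :
    invImage X ⊆ (fun x : ℝ => (x : ℂ)) '' Set.Icc 0 1 := by
  rintro _ (rfl | ⟨x, hx, rfl⟩)
  · exact ⟨0, by simp, by simp⟩
  · have hx0 : 0 ≤ x := hX hx
    exact ⟨(x + 1)⁻¹, ⟨by positivity, inv_le_one_of_one_le₀ (by linarith)⟩, by push_cast; rfl⟩

end FunCalc

/-! ### Covariance, wandering bumps and the isomorphism theorem -/

section Covariance

open Filter Topology

variable {X Y : Set ℝ} {q : ℝ}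
variable {H : Type u} [NormedAddCommGroup H] [InnerProductSpace ℂ H] [CompleteSpace H]
  {T : H →ₗ.[ℂ] H}

/-- Conjugation by `u` is a `*`-automorphism and commutes with the functional calculus of the
resolvent; `hcov` then turns it into the substitution `t ↦ q t`. -/
lemma funCalc₀_alpha (hq : 0 < q) (hX : X ⊆ Set.Ici 0) (hXq : IsQInvariant q X)
    (hXY : X \ {0} ⊆ Y) (hY : IsQInvariant q Y)
    (hs : spectrum ℂ (opResolvent T (-1)) ⊆ invImage X)
    (hn : IsStarNormal (opResolvent T (-1))) {u : H →L[ℂ] H} (hu : u ∈ unitary (H →L[ℂ] H))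
    (hcov : u * opResolvent T (-1) * star u = cfc (rescale q) (opResolvent T (-1)))
    (f : C₀(Y, ℂ)) :
    u * funCalc₀ T f = funCalc₀ T (alpha (dilation hq hY) 1 f) * u := by
  set R := opResolvent T (-1) with hR
  have hc := continuousOn_compactify_extendZero hX hXY f
  have hmaps : rescale q '' spectrum ℂ R ⊆ invImage X := by
    rintro _ ⟨r, hr, rfl⟩
    rcases hs hr with rfl | ⟨x, hx, rfl⟩
    · left
      simp [rescale]
    · right
      exact ⟨q * x, (hXq.mem_iff hq x).1 hx, (rescale_inv hq (hX hx)).symm⟩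
  have hcr : ContinuousOn (rescale q) (spectrum ℂ R) := by
    refine ContinuousOn.div (by fun_prop) (by fun_prop) fun r hr => ?_
    obtain ⟨ρ, hρ, rfl⟩ := invImage_subset_Icc hX (hs hr)
    have := (denom_pos hq hρ.1 hρ.2).ne'
    beta_reduce
    exact_mod_cast this
  have h1 : u * cfc (compactify (extendZero f)) R * star u =
      cfc (compactify (extendZero f)) (u * R * star u) := by
    have hφ : Continuous (Unitary.conjStarAlgAut ℂ (H →L[ℂ] H) ⟨u, hu⟩) := by
      change Continuous fun a : H →L[ℂ] H => u * a * star u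
      fun_prop
    have := StarAlgHomClass.map_cfc (Unitary.conjStarAlgAut ℂ (H →L[ℂ] H) ⟨u, hu⟩)
      (compactify (extendZero f)) R (hc.mono hs) hφ hn (by
        simp only [Unitary.conjStarAlgAut_apply]
        rw [hcov]
        exact cfc_predicate _ _)
    simpa only [Unitary.conjStarAlgAut_apply] using this
  have h2 : cfc (compactify (extendZero f)) (u * R * star u) =
      cfc (compactify (extendZero (alpha (dilation hq hY) 1 f))) R := by
    rw [hcov, ← cfc_comp _ _ R hn (hc.mono hmaps) hcr]
    refine cfc_congr fun r hr => ?_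
    rcases hs hr with rfl | ⟨x, hx, rfl⟩
    · simp [rescale, compactify]
    · have hx0 : 0 ≤ x := hX hx
      simp only [Function.comp_apply]
      rw [rescale_inv hq hx0, compactify_inv _ hx0, compactify_inv _ (by positivity),
        extendZero_alpha]
  rw [funCalc₀_eq, funCalc₀_eq, ← hR, ← h2, ← h1, mul_assoc, mul_assoc,
    Unitary.star_mul_self_of_mem hu, mul_one]

lemma zpow_opZPow {u : H →L[ℂ] H} (hu : u ∈ unitary (H →L[ℂ] H)) (k : ℤ) :
    (((⟨u, hu⟩ : unitary (H →L[ℂ] H)) ^ k : unitary (H →L[ℂ] H)) : H →L[ℂ] H) = opZPow u k := by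
  cases k with
  | ofNat n => simp [opZPow]
  | negSucc n => simp [opZPow, zpow_negSucc, ← Unitary.star_eq_inv]

/-- Tent functions at a nonzero point whose translates under the dilation are disjoint. -/
lemma exists_wandering_bump (hq : 0 < q) (hq1 : q < 1) (hX : X ⊆ Set.Ici 0) (hXc : IsClosed X)
    (hYX : Y ⊆ X) (hXY : X \ {0} ⊆ Y) (hY : IsQInvariant q Y) (y : Y) (hy : (y : ℝ) ≠ 0) :
    ∃ g : C₀(Y, ℂ), g y = 1 ∧ ‖g‖ ≤ 1 ∧
      ∀ j : ℤ, j ≠ 0 → g * alpha (dilation hq hY) j g = 0 := by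
  have hy0 : 0 < (y : ℝ) := lt_of_le_of_ne (hX (hYX y.2)) hy.symm
  -- Chosen so that `q (y + δ) = y - δ`: the open interval of radius `δ` about `y` is then disjoint
  -- from all its dilates by `qʲ`, `j ≠ 0`.
  set δ : ℝ := y * (1 - q) / (1 + q) with hδ
  have hδ0 : 0 < δ := by
    have : 0 < 1 - q := by linarith
    positivity
  have hδq : q * (y + δ) = y - δ := by
    rw [hδ]
    field_simp
    ring
  have hδy : δ < y := by
    have : 0 < q * (y + δ) := by positivity
    linarith
  let t : ℝ → ℝ := fun x => max 0 (1 - |x - y| / δ)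
  have ht : Continuous t := by fun_prop
  have ht0 : ∀ x, t x ≠ 0 → |x - y| < δ := by
    intro x hx
    by_contra! h
    apply hx
    have : 1 ≤ |x - y| / δ := (one_le_div hδ0).2 h
    exact max_eq_left (by linarith)
  have ht1 : ∀ x, |t x| ≤ 1 := by
    intro x
    rw [abs_of_nonneg (le_max_left _ _)]
    have : 0 ≤ |x - y| / δ := by positivity
    exact max_le zero_le_one (by linarith)
  let g : C₀(Y, ℂ) :=
    { toFun := fun x => ((t x : ℝ) : ℂ)
      continuous_toFun := by fun_prop
      zero_at_infty' := by
        refine tendsto_const_nhds.congr' ?_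
        have hK : IsCompact ((fun x : Y => (x : ℝ)) ⁻¹' Metric.closedBall (y : ℝ) δ) := by
          rw [Subtype.isCompact_iff, Subtype.image_preimage_coe]
          -- As `δ < y`, the ball avoids `0`, the only point where `Y` and the closed set `X` may
          -- differ; so the support is compact in `Y`.
          have : Y ∩ Metric.closedBall (y : ℝ) δ = Metric.closedBall (y : ℝ) δ ∩ X := by
            ext x
            refine ⟨fun h => ⟨h.2, hYX h.1⟩, fun h => ⟨hXY ⟨h.2, ?_⟩, h.1⟩⟩
            rintro rfl
            have h1 := h.1
            rw [Metric.mem_closedBall, Real.dist_eq, zero_sub, abs_neg, abs_of_pos hy0] at h1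
            linarith
          rw [this]
          exact (isCompact_closedBall _ _).inter_right hXc
        filter_upwards [hK.compl_mem_cocompact] with x hx
        by_contra h
        apply hx
        have h1 := ht0 x (fun h' => h (by simp [h']))
        rw [Set.mem_preimage, Metric.mem_closedBall, Real.dist_eq]
        exact h1.le }
  have hg : ∀ x : Y, g x = ((t x : ℝ) : ℂ) := fun x => rfl
  refine ⟨g, ?_, ?_, fun j hj => ?_⟩
  · simp [hg, t]
  · rw [← ZeroAtInftyContinuousMap.norm_toBCF_eq_norm]
    refine (BoundedContinuousFunction.norm_le zero_le_one).2 fun x => ?_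
    change ‖g x‖ ≤ 1
    rw [hg, Complex.norm_real]
    exact ht1 x
  · have key : ∀ (n : ℕ) (a b : ℝ), a = q ^ (n + 1) * b → t b = 0 ∨ t a = 0 := by
      intro n a b hab
      by_contra! h
      have hb := abs_lt.1 (ht0 b h.1)
      have ha := abs_lt.1 (ht0 a h.2)
      have hb0 : 0 < b := by linarith
      have h1 : q ^ (n + 1) ≤ q := pow_le_of_le_one hq.le hq1.le n.succ_ne_zero
      have h2 : a ≤ q * b := by rw [hab]; gcongr
      have h3 : q * b < q * (y + δ) := by gcongr; linarith
      linarith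
    ext x
    have hx : (((dilation hq hY) ^ j) x : ℝ) = q ^ j * x := zpow_dilation_apply hq hY j x
    have h0 : t x = 0 ∨ t (((dilation hq hY) ^ j) x : ℝ) = 0 := by
      -- For negative `j` the roles of `x` and `qʲ x` are exchanged.
      rcases j with n | n
      · obtain ⟨m, rfl⟩ : ∃ m, n = m + 1 := Nat.exists_eq_succ_of_ne_zero (by simpa using hj)
        exact key m _ _ (by rw [hx]; exact congrArg (· * (x : ℝ)) (zpow_natCast q (m + 1)))
      · refine (key n _ _ ?_).symm
        rw [hx, zpow_negSucc, mul_inv_cancel_left₀ (pow_pos hq _).ne']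
    change g x * g (((dilation hq hY) ^ j) x) = 0
    rw [hg, hg]
    rcases h0 with h0 | h0 <;> simp [h0]

/-- The bumps exist only at nonzero points. If `0` belongs to `Y`, it is the limit of `qⁿ x` for any
nonzero `x` in `X`. -/
lemma dense_ne_zero (hq : 0 < q) (hq1 : q < 1) (hX : X ≠ {0}) (hXne : X.Nonempty)
    (hXY : X \ {0} ⊆ Y) (hY : IsQInvariant q Y) : Dense {y : Y | (y : ℝ) ≠ 0} := by
  intro y
  by_cases hy : (y : ℝ) = 0
  · obtain ⟨x, hx, hx0⟩ : ∃ x ∈ X, x ≠ 0 := by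
      by_contra! h
      exact hX (Set.eq_singleton_iff_nonempty_unique_mem.2 ⟨hXne, h⟩)
    let x' : Y := ⟨x, hXY ⟨hx, hx0⟩⟩
    have hlim : Tendsto (fun n : ℕ => ((dilation hq hY) ^ (n : ℤ)) x') atTop (𝓝 y) := by
      rw [tendsto_subtype_rng, hy]
      have h1 : ∀ n : ℕ, (((dilation hq hY) ^ (n : ℤ)) x' : ℝ) = q ^ n * x := fun n => by
        rw [zpow_dilation_apply, zpow_natCast]
      simp only [h1]
      simpa using (tendsto_pow_atTop_nhds_zero_of_lt_one hq.le hq1).mul_const x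
    refine mem_closure_of_tendsto hlim (Eventually.of_forall fun n => ?_)
    simp only [Set.mem_ofPred_eq, zpow_dilation_apply]
    exact mul_ne_zero (zpow_ne_zero _ hq.ne') hx0
  · exact subset_closure hy

lemma range_eval_eq_finiteSums {h : Y ≃ₜ Y} {u : H →L[ℂ] H}
    (E : ConvAlg.{u} h →ₗ[ℂ] (H →L[ℂ] H))
    (hE : ∀ k f, E (ConvAlg.mono.{u} h k f) = funCalc₀ T f * opZPow u k) :
    Set.range E = finiteSums T u Y := by
  ext b
  constructor
  · rintro ⟨a, rfl⟩
    obtain ⟨L, hL⟩ := ConvAlg.exists_mem_band a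
    refine ⟨Finset.Icc (-(L : ℤ)) L, fun k => ConvAlg.coeffs h a k, ?_⟩
    conv_lhs => rw [ConvAlg.eq_sum_of_mem_band hL]
    rw [map_sum]
    exact Finset.sum_congr rfl fun k _ => hE _ _
  · rintro ⟨s, f, rfl⟩
    refine ⟨∑ k ∈ s, ConvAlg.mono.{u} h k (f k), ?_⟩
    rw [map_sum]
    exact Finset.sum_congr rfl fun k _ => hE _ _

/-- The inclusions `X \ {0} ⊆ Y ⊆ X` cover both crossed products at once. -/
theorem crossedProductIsoClosure (hq : 0 < q) (hq1 : q < 1) (hX0 : X ⊆ Set.Ici 0)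
    (hXc : IsClosed X) (hXne : X.Nonempty) (hXq : IsQInvariant q X) (hX : X ≠ {0})
    (hYX : Y ⊆ X) (hXY : X \ {0} ⊆ Y) (hY : IsQInvariant q Y) {ζ : H →ₗ.[ℂ] H} {u : H →L[ℂ] H}
    (hζ : IsQNormal q ζ) (hp : IsPolarDecomposition ζ u T)
    (hspec : opSpectrum T = (fun x : ℝ => (x : ℂ)) '' X)
    (hker : ∀ x : T.domain, T x = 0 → x = 0) :
    CrossedProductIsoClosure T u (dilation hq hY) := by
  have hu := hp.mem_unitary hq hζ hker
  have hne1 : ∀ x ∈ X, (x : ℂ) ≠ -1 := by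
    intro x hx h
    have h0 : 0 ≤ x := hX0 hx
    have h1 : x = -1 := by exact_mod_cast h
    linarith
  have hres : IsResolventAt T (-1) (opResolvent T (-1)) := by
    refine isResolventAt_opResolvent ?_
    rw [hspec]
    rintro ⟨x, hx, h⟩
    exact hne1 x hx h
  have hsa := hres.isSelfAdjoint hp.modulus.isSelfAdjoint
  have hn : IsStarNormal (opResolvent T (-1)) := hsa.isStarNormal
  have hs : spectrum ℂ (opResolvent T (-1)) ⊆ invImage X := spectrum_resolvent_subset hres hspec
  have hconj : IsSelfAdjoint (u * opResolvent T (-1) * star u) := hsa.conjugate u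
  have hspecu : spectrum ℂ (u * opResolvent T (-1) * star u) = spectrum ℂ (opResolvent T (-1)) :=
    AlgEquiv.spectrum_eq (Unitary.conjStarAlgAut ℂ (H →L[ℂ] H) ⟨u, hu⟩) (opResolvent T (-1))
  have hcov : u * opResolvent T (-1) * star u = cfc (rescale q) (opResolvent T (-1)) :=
    eq_cfc_rescale hq hn hconj.isStarNormal (hs.trans (invImage_subset_Icc hX0))
      (hspecu.trans_subset (hs.trans (invImage_subset_Icc hX0))) (hp.resolvent_sq hζ hu hres)
  let π : CovRep.{u} (dilation hq hY) :=
    { H := H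
      V := ⟨u, hu⟩
      rep := funCalcHom hX0 hXY hs
      covariant := fun f => funCalc₀_alpha hq hX0 hXq hXY hY hs hn hu hcov f }
  have hrep : ∀ (f : C₀(Y, ℂ)), ∀ y ∈ {y : Y | (y : ℝ) ≠ 0}, ‖f y‖ ≤ ‖π.rep f‖ := by
    intro f y _
    change _ ≤ ‖funCalc₀ T f‖
    rw [funCalc₀_eq]
    have hyX := hYX y.2
    -- Here the spectrum of `T` must be all of `X`: no value of `f` is lost in `f(T)`.
    have hmem : ((y : ℝ) + 1 : ℂ)⁻¹ ∈ spectrum ℂ (opResolvent T (-1)) :=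
      (mem_spectrum_resolvent_iff hres (hne1 _ hyX)).2 (hspec ▸ ⟨y, hyX, rfl⟩)
    have h1 := norm_apply_le_norm_cfc (compactify (extendZero f)) (opResolvent T (-1)) hmem
      ((continuousOn_compactify_extendZero hX0 hXY f).mono hs)
    rw [compactify_inv _ (hX0 hyX)] at h1
    simpa [extendZero] using h1
  have hiso := π.norm_eval_eq (π.norm_coeffs_le (dense_ne_zero hq hq1 hX hXne hXY hY) hrep
    fun y hy => exists_wandering_bump hq hq1 hX0 hXc hYX hXY hY y hy)
  have hmono : ∀ k f, π.eval (ConvAlg.mono.{u} (dilation hq hY) k f) =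
      funCalc₀ T f * opZPow u k := fun k f => by
    rw [π.eval_mono, ← zpow_opZPow hu]
    rfl
  obtain ⟨B, hB, Φ, hΦ⟩ := π.exists_starAlgEquiv hiso
  refine ⟨B, ?_, Φ, fun k f => (hΦ k f).trans (hmono k f)⟩
  rw [hB, ← range_eval_eq_finiteSums π.eval hmono]

end Covariance

/-! ### Weighted permutations of `ℓ²` -/

section Weighted

open Filter Topology

variable {ι : Type u}

lemma memℓp_comp_equiv (σ : ι ≃ ι) {ξ : ι → ℂ} (hξ : Memℓp ξ 2) :
    Memℓp (fun i => ξ (σ i)) 2 := by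
  have h2 : 0 < (2 : ENNReal).toReal := by norm_num
  rw [memℓp_gen_iff h2] at hξ ⊢
  exact (σ.summable_iff (f := fun i => ‖ξ i‖ ^ (2 : ENNReal).toReal)).2 hξ

/-- The unitary operator `(u ξ)(i) = ξ(σ i)` on `ℓ²`. -/
def permute (σ : ι ≃ ι) : lp (fun _ : ι => ℂ) 2 →L[ℂ] lp (fun _ : ι => ℂ) 2 :=
  LinearMap.mkContinuous
    { toFun := fun ξ => ⟨fun i => ξ (σ i), memℓp_comp_equiv σ (lp.memℓp ξ)⟩
      map_add' := fun _ _ => rfl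
      map_smul' := fun _ _ => rfl } 1 fun ξ => by
    have h2 : 0 < (2 : ENNReal).toReal := by norm_num
    rw [one_mul, lp.norm_eq_tsum_rpow h2, lp.norm_eq_tsum_rpow h2]
    exact (congrArg (fun s : ℝ => s ^ (1 / (2 : ENNReal).toReal))
      (σ.tsum_eq fun i => ‖ξ i‖ ^ (2 : ENNReal).toReal)).le

lemma permute_apply (σ : ι ≃ ι) (ξ : lp (fun _ : ι => ℂ) 2) (i : ι) :
    permute σ ξ i = ξ (σ i) := rfl

lemma star_permute (σ : ι ≃ ι) : star (permute σ) = permute σ.symm := by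
  rw [ContinuousLinearMap.star_eq_adjoint]
  symm
  rw [ContinuousLinearMap.eq_adjoint_iff]
  intro ξ η
  rw [lp.inner_eq_tsum, lp.inner_eq_tsum, ← σ.tsum_eq]
  simp only [permute_apply, Equiv.symm_apply_apply]

/-- The bounded diagonal operator `(S ξ)(i) = c i ξ(i)` on `ℓ²`. -/
def diagonal (c : ι → ℂ) (C : ℝ) (hc : ∀ i, ‖c i‖ ≤ C) :
    lp (fun _ : ι => ℂ) 2 →L[ℂ] lp (fun _ : ι => ℂ) 2 :=
  have hle : ∀ (ξ : lp (fun _ : ι => ℂ) 2) (i : ι), ‖c i * ξ i‖ ≤ ‖((C : ℂ) • ξ) i‖ := by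
    intro ξ i
    rw [lp.coeFn_smul, Pi.smul_apply, norm_smul, norm_mul, Complex.norm_real]
    exact mul_le_mul_of_nonneg_right ((hc i).trans (Real.le_norm_self C)) (norm_nonneg _)
  LinearMap.mkContinuous
    { toFun := fun ξ => ⟨fun i => c i * ξ i, (lp.memℓp ((C : ℂ) • ξ)).mono' (hle ξ)⟩
      map_add' := fun ξ η => by
        ext i
        exact mul_add _ _ _
      map_smul' := fun a ξ => by
        ext i
        exact mul_left_comm _ _ _ } ‖(C : ℂ)‖ fun ξ => by
    rw [← norm_smul]
    exact lp.norm_mono two_ne_zero (hle ξ)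

lemma diagonal_apply (c : ι → ℂ) (C : ℝ) (hc : ∀ i, ‖c i‖ ≤ C) (ξ : lp (fun _ : ι => ℂ) 2)
    (i : ι) : diagonal c C hc ξ i = c i * ξ i := rfl

/-- The operator `(W ξ)(i) = w i ξ(σ i)` on `ℓ²`, with its maximal domain. -/
def weighted (σ : ι ≃ ι) (w : ι → ℝ) : lp (fun _ : ι => ℂ) 2 →ₗ.[ℂ] lp (fun _ : ι => ℂ) 2 where
  domain :=
    { carrier := {ξ | Memℓp (fun i => (w i : ℂ) * ξ (σ i)) 2}
      add_mem' := fun {ξ η} hξ hη => by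
        refine (congrArg (Memℓp · 2) ?_).mp (Memℓp.add hξ hη)
        ext i
        exact (mul_add _ _ _).symm
      zero_mem' := by
        refine (congrArg (Memℓp · 2) ?_).mp zero_memℓp
        ext i
        exact (mul_zero _).symm
      smul_mem' := fun a ξ hξ => by
        refine (congrArg (Memℓp · 2) ?_).mp (Memℓp.const_smul hξ a)
        ext i
        exact mul_left_comm _ _ _ }
  toFun :=
    { toFun := fun ξ => ⟨fun i => (w i : ℂ) * (ξ : lp (fun _ : ι => ℂ) 2) (σ i), ξ.2⟩
      map_add' := fun ξ η => by
        ext i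
        exact mul_add _ _ _
      map_smul' := fun a ξ => by
        ext i
        exact mul_left_comm _ _ _ }

lemma mem_graph_weighted {σ : ι ≃ ι} {w : ι → ℝ} {ξ η : lp (fun _ : ι => ℂ) 2} :
    (ξ, η) ∈ (weighted σ w).graph ↔ ∀ i, η i = w i * ξ (σ i) := by
  rw [mem_graph_iff_exists]
  constructor
  · rintro ⟨hξ, rfl⟩ i
    rfl
  · intro h
    have hξ : ξ ∈ (weighted σ w).domain := by
      change Memℓp (fun i => (w i : ℂ) * ξ (σ i)) 2
      rw [← funext h]
      exact lp.memℓp η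
    refine ⟨hξ, ?_⟩
    ext i
    exact (h i).symm

lemma mem_graph_weighted_single [DecidableEq ι] (σ : ι ≃ ι) (w : ι → ℝ) (i : ι) :
    (lp.single 2 (σ i) (1 : ℂ), lp.single 2 i (w i : ℂ)) ∈ (weighted σ w).graph := by
  rw [mem_graph_weighted]
  intro j
  rcases eq_or_ne j i with rfl | hj
  · simp
  · rw [lp.single_apply_ne _ _ _ hj, lp.single_apply_ne _ _ _ (σ.injective.ne hj), mul_zero]

lemma dense_domain_weighted (σ : ι ≃ ι) (w : ι → ℝ) :
    Dense ((weighted σ w).domain : Set (lp (fun _ : ι => ℂ) 2)) := by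
  classical
  rw [Submodule.dense_iff_topologicalClosure_eq_top, Submodule.topologicalClosure_eq_top_iff,
    Submodule.eq_bot_iff]
  intro ξ hξ
  ext j
  obtain ⟨hm, -⟩ := mem_graph_iff_exists.1 (mem_graph_weighted_single σ w (σ.symm j))
  rw [σ.apply_symm_apply] at hm
  have := (Submodule.mem_orthogonal _ _).1 hξ _ hm
  rw [lp.inner_single_left] at this
  simpa using this

/-- Testing against basis vectors determines the adjoint coordinatewise, and the maximal domain on
the right imposes nothing more than square summability. -/
lemma adjoint_weighted (σ : ι ≃ ι) (w : ι → ℝ) :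
    (weighted σ w).adjoint = weighted σ.symm (fun i => w (σ.symm i)) := by
  classical
  apply LinearPMap.eq_of_eq_graph
  ext ⟨η, ω⟩
  rw [mem_graph_adjoint (dense_domain_weighted σ w), mem_graph_weighted]
  constructor
  · intro h j
    have := h _ _ (mem_graph_weighted_single σ w (σ.symm j))
    rw [lp.inner_single_left, lp.inner_single_left, σ.apply_symm_apply] at this
    simpa [mul_comm] using this.symm
  · intro h ξ v hv
    rw [mem_graph_weighted] at hv
    rw [lp.inner_eq_tsum, lp.inner_eq_tsum, ← σ.tsum_eq fun i => ⟪ξ i, ω i⟫_ℂ]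
    refine tsum_congr fun i => ?_
    rw [hv, h, σ.symm_apply_apply]
    simp only [RCLike.inner_apply, map_mul, Complex.conj_ofReal]
    ring

lemma isClosed_weighted (σ : ι ≃ ι) (w : ι → ℝ) : (weighted σ w).IsClosed := by
  have h := LinearPMap.adjoint_isClosed (dense_domain_weighted σ.symm (fun i => w (σ.symm i)))
  rw [adjoint_weighted] at h
  simpa using h

lemma separableSpace_l2 [Countable ι] :
    TopologicalSpace.SeparableSpace (lp (fun _ : ι => ℂ) 2) := by
  let b : HilbertBasis ι ℂ (lp (fun _ : ι => ℂ) 2) := default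
  have h1 : TopologicalSpace.IsSeparable
      (closure (Submodule.span ℂ (Set.range b) : Set (lp (fun _ : ι => ℂ) 2))) :=
    (Set.countable_range b).isSeparable.span.closure
  rw [← Submodule.topologicalClosure_coe, b.dense_span, Submodule.top_coe] at h1
  exact TopologicalSpace.isSeparable_univ_iff.1 h1

lemma opSpectrum_weighted_refl (x : ι → ℝ) :
    opSpectrum (weighted (Equiv.refl ι) x) = (fun x : ℝ => (x : ℂ)) '' closure (Set.range x) := by
  classical
  have hcl : (fun x : ℝ => (x : ℂ)) '' closure (Set.range x) =
      closure (Set.range fun i => (x i : ℂ)) := by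
    rw [← Complex.isometry_ofReal.isClosedEmbedding.closure_image_eq, ← Set.range_comp]
    rfl
  rw [hcl]
  ext z
  rw [← not_iff_not]
  simp only [opSpectrum, Set.mem_ofPred_eq, not_not]
  constructor
  · rintro ⟨S, hS⟩ hz
    rw [isResolventAt_iff] at hS
    -- If `x i` is within `(‖S‖ + 1)⁻¹` of `z`, then `eᵢ = (x i - z) S eᵢ` would have norm less than
    -- `1`.
    have hS0 : 0 < (‖S‖ + 1)⁻¹ := by positivity
    obtain ⟨_, ⟨i, rfl⟩, hi⟩ := Metric.mem_closure_iff.1 hz _ hS0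
    have h1 := hS.2 _ _ (mem_graph_weighted_single (Equiv.refl ι) x i)
    have h2 : lp.single 2 i (x i : ℂ) - z • lp.single 2 ((Equiv.refl ι) i) (1 : ℂ) =
        ((x i : ℂ) - z) • (lp.single 2 i (1 : ℂ) : lp (fun _ : ι => ℂ) 2) := by
      rw [sub_smul, ← lp.single_smul, ← lp.single_smul, ← lp.single_smul, smul_eq_mul, smul_eq_mul,
        mul_one, mul_one, Equiv.refl_apply]
    rw [h2, map_smul] at h1
    have h3 := congrArg norm h1
    rw [norm_smul, Equiv.refl_apply, lp.norm_single two_pos, norm_one] at h3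
    have h4 : ‖S (lp.single 2 i (1 : ℂ))‖ ≤ ‖S‖ := by
      have := S.le_opNorm (lp.single 2 i (1 : ℂ))
      rwa [lp.norm_single two_pos, norm_one, mul_one] at this
    rw [dist_comm, dist_eq_norm] at hi
    have h5 : ‖(x i : ℂ) - z‖ * ‖S (lp.single 2 i (1 : ℂ))‖ ≤ (‖S‖ + 1)⁻¹ * ‖S‖ :=
      mul_le_mul hi.le h4 (norm_nonneg _) hS0.le
    rw [h3, inv_mul_eq_div, one_le_div (by positivity)] at h5
    linarith
  · intro hz
    obtain ⟨ε, hε, hzε⟩ : ∃ ε > 0, ∀ i, ε ≤ ‖(x i : ℂ) - z‖ := by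
      rw [Metric.mem_closure_iff] at hz
      push Not at hz
      obtain ⟨ε, hε, h⟩ := hz
      refine ⟨ε, hε, fun i => ?_⟩
      rw [← dist_eq_norm, dist_comm]
      exact h _ ⟨i, rfl⟩
    have hne : ∀ i, (x i : ℂ) - z ≠ 0 := fun i h => by
      have := hzε i
      rw [h, norm_zero] at this
      linarith
    refine ⟨diagonal (fun i => ((x i : ℂ) - z)⁻¹) ε⁻¹ fun i => ?_, isResolventAt_iff.2
      ⟨fun ξ => mem_graph_weighted.2 fun i => ?_, fun ξ η h => ?_⟩⟩
    · rw [norm_inv]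
      exact inv_anti₀ hε (hzε i)
    · rw [Equiv.refl_apply, lp.coeFn_add, Pi.add_apply, lp.coeFn_smul, Pi.smul_apply,
        diagonal_apply, smul_eq_mul]
      have := hne i
      field_simp
      ring
    · ext i
      rw [diagonal_apply, lp.coeFn_sub, Pi.sub_apply, lp.coeFn_smul, Pi.smul_apply,
        mem_graph_weighted.1 h i, Equiv.refl_apply, smul_eq_mul, ← sub_mul,
        inv_mul_cancel_left₀ (hne i)]

lemma inner_weighted_refl_nonneg {x : ι → ℝ} (hx : ∀ i, 0 ≤ x i)
    (ξ : (weighted (Equiv.refl ι) x).domain) :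
    0 ≤ (⟪(ξ : lp (fun _ : ι => ℂ) 2), weighted (Equiv.refl ι) x ξ⟫_ℂ).re := by
  have h1 := Complex.reCLM.hasSum
    (lp.hasSum_inner (𝕜 := ℂ) (ξ : lp (fun _ : ι => ℂ) 2) (weighted (Equiv.refl ι) x ξ))
  refine h1.nonneg fun i => ?_
  have h2 : (weighted (Equiv.refl ι) x ξ) i = x i * (ξ : lp (fun _ : ι => ℂ) 2) i := rfl
  simp only [h2, RCLike.inner_apply, Complex.reCLM_apply]
  rw [mul_assoc, Complex.mul_conj, ← Complex.ofReal_mul, Complex.ofReal_re]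
  exact mul_nonneg (hx i) (Complex.normSq_nonneg _)

variable {q : ℝ} {x : ι → ℝ} {σ : ι ≃ ι}

lemma weighted_eq_compPMap (hσ : ∀ i, x (σ i) = q * x i) :
    weighted σ (fun i => q * x i) =
      (permute σ : lp (fun _ : ι => ℂ) 2 →ₗ[ℂ] lp (fun _ : ι => ℂ) 2).compPMap
        (weighted (Equiv.refl ι) x) := by
  apply LinearPMap.eq_of_eq_graph
  ext ⟨ξ, η⟩
  simp only [mem_graph_compPMap, mem_graph_weighted]
  constructor
  · intro h
    refine ⟨permute σ.symm η, fun i => ?_, ?_⟩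
    · rw [permute_apply, h, ← hσ, σ.apply_symm_apply, Equiv.refl_apply]
    · ext i
      exact congrArg η (σ.symm_apply_apply i)
  · rintro ⟨y, hy, rfl⟩ i
    change permute σ y i = _
    rw [permute_apply, hy, hσ, Equiv.refl_apply]

lemma adjoint_weighted_dilation (hσ : ∀ i, x (σ i) = q * x i) :
    (weighted σ (fun i => q * x i)).adjoint = weighted σ.symm x := by
  rw [adjoint_weighted]
  congr 1
  ext i
  rw [← hσ, σ.apply_symm_apply]

lemma isQNormal_weighted (hq : 0 < q) (hσ : ∀ i, x (σ i) = q * x i) :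
    IsQNormal q (weighted σ (fun i => q * x i)) where
  dense_domain := dense_domain_weighted _ _
  isClosed := isClosed_weighted _ _
  comm := by
    have hq0 : (q : ℂ) ≠ 0 := Complex.ofReal_ne_zero.2 hq.ne'
    have hσ' : ∀ i, (x (σ i) : ℂ) = q * x i := fun i => by rw [hσ]; push_cast; rfl
    rw [adjoint_weighted_dilation hσ]
    apply LinearPMap.eq_of_eq_graph
    ext ⟨ξ, η⟩
    simp only [mem_graph_smul, mem_graph_opComp, mem_graph_weighted]
    constructor
    · rintro ⟨y, hy, hη⟩
      -- With `y = ζ* ξ`, the witness is `ζ ξ = q⁻¹ u² ζ* ξ`, which shows `ξ` is in the domain of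
      -- `ζ`. The converse uses `ζ* ξ = q u*² ζ ξ`.
      refine ⟨((q : ℂ) ^ 2)⁻¹ • η, ⟨(q : ℂ)⁻¹ • permute σ (permute σ y), fun i => ?_, fun i => ?_⟩,
        smul_inv_smul₀ (pow_ne_zero 2 hq0) η⟩
      · rw [lp.coeFn_smul, Pi.smul_apply, permute_apply, permute_apply, hy, σ.symm_apply_apply,
          hσ', hσ', smul_eq_mul]
        push_cast
        field_simp
      · rw [lp.coeFn_smul, Pi.smul_apply, lp.coeFn_smul, Pi.smul_apply, permute_apply,
          permute_apply, σ.apply_symm_apply, hη, smul_eq_mul, smul_eq_mul]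
        push_cast
        field_simp
    · rintro ⟨z, ⟨y, hy, hz⟩, rfl⟩
      refine ⟨(q : ℂ) • permute σ.symm (permute σ.symm y), fun i => ?_, fun i => ?_⟩
      · rw [lp.coeFn_smul, Pi.smul_apply, permute_apply, permute_apply, hy, ← hσ,
          σ.apply_symm_apply, smul_eq_mul, ← mul_assoc]
        have := hσ' (σ.symm i)
        rw [σ.apply_symm_apply] at this
        rw [← this]
      · rw [lp.coeFn_smul, Pi.smul_apply, lp.coeFn_smul, Pi.smul_apply, permute_apply,
          permute_apply, σ.symm_apply_apply, hz, smul_eq_mul, smul_eq_mul]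
        push_cast
        ring

lemma isPolarDecomposition_weighted (hq : 0 < q) (hx : ∀ i, 0 < x i)
    (hσ : ∀ i, x (σ i) = q * x i) :
    IsPolarDecomposition (weighted σ (fun i => q * x i)) (permute σ)
      (weighted (Equiv.refl ι) x) where
  modulus :=
    { isSelfAdjoint := adjoint_weighted (Equiv.refl ι) x
      nonneg := inner_weighted_refl_nonneg fun i => (hx i).le
      sq := by
        rw [adjoint_weighted_dilation hσ]
        apply LinearPMap.eq_of_eq_graph
        ext ⟨ξ, η⟩
        simp only [mem_graph_opComp, mem_graph_weighted, Equiv.refl_apply]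
        constructor
        · rintro ⟨y, hy, hη⟩
          refine ⟨permute σ y, fun i => ?_, fun i => ?_⟩
          · rw [permute_apply, hy, hσ]
          · rw [permute_apply, σ.apply_symm_apply, hη]
        · rintro ⟨y, hy, hη⟩
          refine ⟨permute σ.symm y, fun i => ?_, fun i => ?_⟩
          · rw [permute_apply, hy, ← hσ, σ.apply_symm_apply]
          · rw [permute_apply, hη] }
  partialIsometry := by
    rw [star_permute]
    ext ξ i
    exact congrArg ξ (by simp)
  ker_eq := by
    intro ξ
    have h1 : permute σ ξ = 0 ↔ ξ = 0 := by
      refine ⟨fun h => ?_, fun h => by rw [h, map_zero]⟩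
      ext i
      have h2 : permute σ ξ (σ.symm i) = 0 := by rw [h]; rfl
      rwa [permute_apply, σ.apply_symm_apply] at h2
    rw [h1, ← mem_graph_iff_exists, mem_graph_weighted]
    constructor
    · rintro rfl i
      exact (mul_zero _).symm
    · intro h
      ext i
      have h2 := (h (σ.symm i)).symm
      rw [σ.apply_symm_apply] at h2
      exact (mul_eq_zero.1 h2).resolve_left
        (Complex.ofReal_ne_zero.2 (mul_pos hq (hx _)).ne')
  eq_comp := weighted_eq_compPMap hσ

end Weighted

/-! ### Existence of a `q`-normal operator with prescribed spectrum -/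

section Existence

open Filter Topology

/-- Saturating a countable dense subset of `X \ {0}` under the powers of `q` keeps it countable.
Omitting `0` makes the kernel of the multiplication operator trivial, while density of `X \ {0}` in
`X` keeps `0` in its spectrum. -/
lemma exists_countable_invariant_dense {q : ℝ} (hq : 0 < q) (hq1 : q < 1) {X : Set ℝ}
    (hXne : X.Nonempty) (hXc : IsClosed X) (hXq : IsQInvariant q X) (hX : X ≠ {0}) :
    ∃ D : Set ℝ, D.Countable ∧ IsQInvariant q D ∧ D ⊆ X \ {0} ∧ closure D = X := by
  have hXq' := hXq.diff_zero hq
  obtain ⟨D, hDX, hDc, hD⟩ := (TopologicalSpace.IsSeparable.of_separableSpace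
    (X \ {0})).exists_countable_dense_subset
  have hinv : ∀ n : ℤ, ∀ x ∈ X \ {0}, q ^ n * x ∈ X \ {0} := fun n x hx => by
    have h1 := (((dilation hq hXq') ^ n) ⟨x, hx⟩).2
    rwa [zpow_dilation_apply] at h1
  refine ⟨⋃ n : ℤ, (fun x => q ^ n * x) '' D, Set.countable_iUnion fun n => hDc.image _, ?_, ?_, ?_⟩
  · ext x
    simp only [Set.image_iUnion, Set.mem_iUnion, Set.mem_image, exists_exists_and_eq_and]
    constructor
    · rintro ⟨n, d, hd, rfl⟩
      exact ⟨n + 1, d, hd, by rw [zpow_add_one₀ hq.ne']; ring⟩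
    · rintro ⟨n, d, hd, rfl⟩
      refine ⟨n - 1, d, hd, ?_⟩
      rw [zpow_sub_one₀ hq.ne']
      field_simp
  · simp only [Set.iUnion_subset_iff, Set.image_subset_iff]
    exact fun n x hx => hinv n x (hDX hx)
  · refine Set.Subset.antisymm (closure_minimal ?_ hXc) ?_
    · simp only [Set.iUnion_subset_iff, Set.image_subset_iff]
      exact fun n x hx => (hinv n x (hDX hx)).1
    · have h1 : X \ {0} ⊆ closure (⋃ n : ℤ, (fun x => q ^ n * x) '' D) :=
        hD.trans (closure_mono fun x hx => Set.mem_iUnion.2 ⟨0, x, hx, by simp⟩)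
      have h2 : X ⊆ closure (X \ {0}) := fun x hx => by
        have h3 := dense_ne_zero hq hq1 hX hXne Set.sdiff_subset hXq ⟨x, hx⟩
        refine closure_mono ?_ (image_closure_subset_closure_image continuous_subtype_val
          (Set.mem_image_of_mem _ h3))
        rintro _ ⟨y, hy, rfl⟩
        exact ⟨y.2, hy⟩
      exact h2.trans (closure_minimal h1 isClosed_closure)

theorem exists_isQNormal {q : ℝ} (hq : 0 < q) (hq1 : q < 1) {X : Set ℝ}
    (hX0 : X ⊆ Set.Ici 0) (hXc : IsClosed X) (hXne : X.Nonempty) (hXq : IsQInvariant q X)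
    (hX : X ≠ {0}) :
    ∃ (H : Type u) (_ : NormedAddCommGroup H) (_ : InnerProductSpace ℂ H) (_ : CompleteSpace H)
      (_ : TopologicalSpace.SeparableSpace H)
      (ζ : H →ₗ.[ℂ] H) (u : H →L[ℂ] H) (T : H →ₗ.[ℂ] H),
        IsQNormal q ζ ∧ IsPolarDecomposition ζ u T ∧
          opSpectrum T = (fun x : ℝ => (x : ℂ)) '' X ∧ ∀ x : T.domain, T x = 0 → x = 0 := by
  obtain ⟨D, hDc, hDq, hDX, hDcl⟩ := exists_countable_invariant_dense hq hq1 hXne hXc hXq hX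
  have : Countable D := hDc.to_subtype
  let x : ULift.{u} D → ℝ := fun i => i.down
  let σ : ULift.{u} D ≃ ULift.{u} D :=
    (Equiv.ulift.trans (dilation hq hDq).toEquiv).trans Equiv.ulift.symm
  have hx : ∀ i, 0 < x i := fun i =>
    lt_of_le_of_ne (hX0 (hDX i.down.2).1) (Ne.symm (hDX i.down.2).2)
  have hσ : ∀ i, x (σ i) = q * x i := fun i => rfl
  have hrange : Set.range x = D := by
    ext t
    constructor
    · rintro ⟨i, rfl⟩
      exact i.down.2
    · exact fun ht => ⟨⟨⟨t, ht⟩⟩, rfl⟩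
  refine ⟨lp (fun _ : ULift.{u} D => ℂ) 2, inferInstance, inferInstance, inferInstance,
    separableSpace_l2, weighted σ (fun i => q * x i), permute σ, weighted (Equiv.refl _) x,
    isQNormal_weighted hq hσ, isPolarDecomposition_weighted hq hx hσ, ?_, fun ξ hξ => ?_⟩
  · rw [opSpectrum_weighted_refl, hrange, hDcl]
  · ext i
    have h1 : ((ξ : lp (fun _ : ULift.{u} D => ℂ) 2), 0) ∈ (weighted (Equiv.refl _) x).graph :=
      mem_graph_iff_exists.2 ⟨ξ.2, hξ⟩
    have h2 := (mem_graph_weighted.1 h1 i).symm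
    exact (mul_eq_zero.1 h2).resolve_left (Complex.ofReal_ne_zero.2 (hx i).ne')

end Existence

end QPlane

end

open QPlane in
theorem proposition3p1 (q : ℝ) (hq : 0 < q) (hq1 : q < 1) (X : Set ℝ)
    (hX0 : X ⊆ Set.Ici 0) (hXc : IsClosed X) (hXne : X.Nonempty) (hXq : IsQInvariant q X)
    (hX : X ≠ {0}) :
    (∃ (H : Type u) (_ : NormedAddCommGroup H) (_ : InnerProductSpace ℂ H) (_ : CompleteSpace H)
      (_ : TopologicalSpace.SeparableSpace H)
      (ζ : H →ₗ.[ℂ] H) (u : H →L[ℂ] H) (T : H →ₗ.[ℂ] H),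
        IsQNormal q ζ ∧ IsPolarDecomposition ζ u T ∧
          opSpectrum T = (fun x : ℝ => (x : ℂ)) '' X ∧ ∀ x : T.domain, T x = 0 → x = 0) ∧
    (∀ (H : Type u) [NormedAddCommGroup H] [InnerProductSpace ℂ H] [CompleteSpace H]
      (ζ : H →ₗ.[ℂ] H) (u : H →L[ℂ] H) (T : H →ₗ.[ℂ] H),
        IsQNormal q ζ → IsPolarDecomposition ζ u T →
        opSpectrum T = (fun x : ℝ => (x : ℂ)) '' X → (∀ x : T.domain, T x = 0 → x = 0) →
          CrossedProductIsoClosure T u (dilation hq hXq) ∧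
          CrossedProductIsoClosure T u (dilation hq (hXq.diff_zero hq))) := by
  refine ⟨exists_isQNormal hq hq1 hX0 hXc hXne hXq hX, ?_⟩
  intro H _ _ _ ζ u T hζ hp hspec hker
  exact ⟨crossedProductIsoClosure hq hq1 hX0 hXc hXne hXq hX subset_rfl Set.sdiff_subset hXq hζ hp
      hspec hker,
    crossedProductIsoClosure hq hq1 hX0 hXc hXne hXq hX Set.sdiff_subset subset_rfl
      (hXq.diff_zero hq) hζ hp hspec hker⟩
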